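/- **Theorem 1.2.** Let $n\ge 1$, $0<\alpha<n$, $1<p\le q<\infty$, $1/p+1/p'=1$, and $c>0$. There is a constant $C=C(n,\alpha,p,q,c)<\infty$ such that the following holds. Let $\varepsilon_q:[1,\infty)\to(0,\infty)$ be a monotone increasing (i.e. non-decreasing) function with $\varepsilon_q(1)\ge c$ and $$\int_1^\infty \frac{dt}{t\,\varepsilon_q(t)^q}=1 .$$ Let $\sigma,w$ be weights on $\mathbb R^n$, i.e. non-negative locally integrable functions; for a set $E$ write $\sigma(E)=\int_E\sigma\,dx$, $w(E)=\int_E w\,dx$, and $|E|$ for Lebesgue measure. For $0\le a<n$ and a measurable function $g$ put $$M_a g(x)=\sup_{Q\ni x}\frac1{|Q|^{1-a/n}}\int_Q|g(y)|\,dy ,$$ the supremum being over all axis-parallel cubes $Q\subset\mathbb R^n$ containing $x$, and let $M=M_0$ be the Hardy–Littlewood maximal operator. For a cube $Q$ put $$\rho_\sigma(Q)=\frac1{\sigma(Q)}\int_Q M(\sigma\mathbf 1_Q)\,dx\in[1,\infty],\qquad \beta(Q)=\frac{\sigma(Q)^{1/p'}\,w(Q)^{1/q}}{|Q|^{1-\alpha/n}}\;\rho_\sigma(Q)^{1/p}\,\varepsilon_q(\rho_\sigma(Q)),$$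 where $\varepsilon_q(\infty)=\infty$ and $\beta(Q)=0$ if $\sigma(Q)=0$ or $w(Q)=0$, and let $\lceil\sigma,w\rceil=\sup_Q\beta(Q)\in[0,\infty]$, the supremum being over all axis-parallel cubes. Then for every measurable $f$, $$\|M_\alpha(f\sigma)\|_{L^q(w)}\le C\,\lceil\sigma,w\rceil\,\|f\|_{L^p(\sigma)}$$ (in $[0,\infty]$, with $0\cdot\infty=0$). In particular, $f\mapsto M_\alpha(f\sigma)$ is bounded from $L^p(\sigma)$ to $L^q(w)$ if $\lceil\sigma,w\rceil<\infty$. -/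

import Mathlib

open MeasureTheory
open scoped ENNReal NNReal

namespace EntropyBump

noncomputable section

/-- An axis-parallel cube in `ℝⁿ`: a corner and a positive side length. -/
structure Cube (n : ℕ) where
  corner : Fin n → ℝ
  side : ℝ
  side_pos : 0 < side

/-- The (half-open) set of points of a cube. -/
def Cube.toSet {n : ℕ} (Q : Cube n) : Set (Fin n → ℝ) :=
  Set.univ.pi fun i => Set.Ico (Q.corner i) (Q.corner i + Q.side)

/-- A weight on `ℝⁿ`: a non-negative, locally integrable function. -/
structure IsWeight {n : ℕ} (σ : (Fin n → ℝ) → ℝ) : Prop where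
  nonneg : ∀ x, 0 ≤ σ x
  locallyIntegrable : LocallyIntegrable σ volume

/-- The measure `σ dx` with density `σ`. -/
def wMeasure {n : ℕ} (σ : (Fin n → ℝ) → ℝ) : Measure (Fin n → ℝ) :=
  volume.withDensity fun x => ENNReal.ofReal (σ x)

/-- The (uncentred) fractional maximal function
`M_α f (x) = sup_{Q ∋ x} |Q|^{-(1 - α/n)} ∫_Q |f|`, with values in `[0, ∞]`. -/
def fracMaximal {n : ℕ} (α : ℝ) (f : (Fin n → ℝ) → ℝ) (x : Fin n → ℝ) : ℝ≥0∞ :=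
  ⨆ (Q : Cube n) (_ : x ∈ Q.toSet),
    (∫⁻ y in Q.toSet, ‖f y‖ₑ) / volume Q.toSet ^ (1 - α / (n : ℝ))

/-- The Hardy–Littlewood maximal function, i.e. the case `α = 0`. -/
def hlMaximal {n : ℕ} (f : (Fin n → ℝ) → ℝ) : (Fin n → ℝ) → ℝ≥0∞ :=
  fracMaximal 0 f

/-- `ρ_σ(Q) = σ(Q)⁻¹ ∫_Q M(σ 1_Q)`; it lies in `[1, ∞]` whenever `σ(Q) > 0`,
and it is `0` if `σ(Q) = 0`. -/
def rho {n : ℕ} (σ : (Fin n → ℝ) → ℝ) (Q : Cube n) : ℝ≥0∞ :=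
  (∫⁻ x in Q.toSet, hlMaximal (Q.toSet.indicator σ) x) / wMeasure σ Q.toSet

/-- The value of `ε` at an extended non-negative number, with `ε(∞) = ∞`. -/
def epsAt (ε : ℝ → ℝ) (r : ℝ≥0∞) : ℝ≥0∞ :=
  if r = ∞ then ∞ else ENNReal.ofReal (ε r.toReal)

/-- `β(Q) = σ(Q)^{1/p'} w(Q)^{1/q} |Q|^{-(1 - α/n)} ρ_σ(Q)^{1/p} ε(ρ_σ(Q))`,
with the convention `0 · ∞ = 0`, so that `β(Q) = 0` if `σ(Q) = 0` or `w(Q) = 0`. -/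
def beta {n : ℕ} (α p q : ℝ) (ε : ℝ → ℝ) (σ w : (Fin n → ℝ) → ℝ) (Q : Cube n) : ℝ≥0∞ :=
  wMeasure σ Q.toSet ^ (1 / Real.conjExponent p) * wMeasure w Q.toSet ^ (1 / q)
    / volume Q.toSet ^ (1 - α / (n : ℝ))
    * rho σ Q ^ (1 / p) * epsAt ε (rho σ Q)

/-- The one-bump constant `⌈σ, w⌉ = sup_Q β(Q)`, the supremum over all cubes. -/
def bump {n : ℕ} (α p q : ℝ) (ε : ℝ → ℝ) (σ w : (Fin n → ℝ) → ℝ) : ℝ≥0∞ :=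
  ⨆ Q : Cube n, beta α p q ε σ w Q

end

end EntropyBump

namespace EntropyBump

/-! ### Principal families, laminar families, geometric sums and averages -/

section

/-! Write l(Q) = |Q|^{-(1-α/n)} ∫_Q |f| dσ. By the one-third trick, M_α(fσ) is at most 6^n times the
largest of 2^n dyadic maximal functions (`fracMaximal_rpow_le`), so a single grid suffices, and by
monotone convergence a finite part of it. `exists_principal` selects cubes S along which l more than
doubles when passing to a smaller cube, while every l(Q) is at most twice l of a selected cube
containing Q. The integral is then at most 2^q ∑_{Q ∈ S} l(Q)^q w(Q).

Doubling of l makes S sparse: each cube keeps at least half of its volume outside the smaller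
selected ones (`measure_le_two_mul_ownPart`). Comparing means of σ with M(σ 1_R) on these disjoint
parts gives the packing bound ∑_{Q ⊆ R} σ(Q) ≤ 2 ρ(R) σ(R). Hence the cubes with 2^k ≤ ρ < 2^{k+1}
satisfy a Carleson condition with constant 4·2^k, and `carleson_embedding` applies to them at the
cost of 2^k.

The bump pays for this. `fracAvg_rpow_mul_le` bounds l(Q)^q w(Q) by ρ⁻¹ ε(ρ)^{-q} times the Carleson
term: the factor ρ⁻¹ cancels 2^k, and ∑_k ε(2^k)^{-q} is finite by `tsum_inv_eps_le`. -/

/-- A family of sets any two of which are disjoint or nested. -/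
def Laminar {ι X : Type*} (s : ι → Set X) : Prop :=
  ∀ i j, s i ⊆ s j ∨ s j ⊆ s i ∨ Disjoint (s i) (s j)

/-- Greedy selection of principal sets. -/
theorem exists_principal {ι X : Type*} {s : ι → Set X}
    (hs : Function.Injective s) (l : ι → ℝ≥0∞) (F : Finset ι) :
    ∃ S ⊆ F, (∀ i ∈ F, ∃ j ∈ S, s i ⊆ s j ∧ l i ≤ 2 * l j) ∧
      ∀ i ∈ S, ∀ j ∈ S, i ≠ j → s i ⊆ s j → 2 * l j < l i := by
  classical
  induction F using Finset.strongInduction with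
  | H F ih =>
    rcases F.eq_empty_or_nonempty with rfl | hF
    · exact ⟨∅, by simp⟩
    -- A minimal set put back last is never the larger one of a nested pair, so the only new
    -- separation condition is the failure of covering.
    obtain ⟨i₀, hi₀, hmin⟩ := F.exists_minimalFor s hF
    obtain ⟨S, hSF, hcov, hsep⟩ := ih (F.erase i₀) (Finset.erase_ssubset hi₀)
    have hSF' : S ⊆ F := hSF.trans (Finset.erase_subset _ _)
    by_cases h : ∃ j ∈ S, s i₀ ⊆ s j ∧ l i₀ ≤ 2 * l j
    · refine ⟨S, hSF', fun i hi => ?_, hsep⟩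
      rcases eq_or_ne i i₀ with rfl | hne
      · exact h
      · exact hcov i (Finset.mem_erase.2 ⟨hne, hi⟩)
    · push Not at h
      refine ⟨insert i₀ S, Finset.insert_subset hi₀ hSF', fun i hi => ?_, ?_⟩
      · rcases eq_or_ne i i₀ with rfl | hne
        · refine ⟨i, Finset.mem_insert_self _ _, subset_rfl, ?_⟩
          rw [two_mul]; exact le_self_add
        · obtain ⟨j, hj, h1, h2⟩ := hcov i (Finset.mem_erase.2 ⟨hne, hi⟩)
          exact ⟨j, Finset.mem_insert_of_mem hj, h1, h2⟩
      · intro i hi j hj hij hsub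
        rcases Finset.mem_insert.1 hi with rfl | hiS
        · rcases Finset.mem_insert.1 hj with rfl | hjS
          · exact absurd rfl hij
          · exact h j hjS hsub
        · rcases Finset.mem_insert.1 hj with rfl | hjS
          · have := hmin (hSF' hiS) hsub
            exact absurd (hs (hsub.antisymm this)) hij
          · exact hsep i hiS j hjS hij hsub

/-- A comparison of measures on each member of a finite laminar family carries over to the union. -/
theorem Laminar.measure_biUnion_le {ι X : Type*} [MeasurableSpace X] {s : ι → Set X}
    (hs : Laminar s) (hm : ∀ i, MeasurableSet (s i)) {μ ν : Measure X} (F : Finset ι)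
    (h : ∀ i ∈ F, μ (s i) ≤ ν (s i)) :
    μ (⋃ i ∈ F, s i) ≤ ν (⋃ i ∈ F, s i) := by
  classical
  suffices H : ∃ G ⊆ F, (⋃ i ∈ G, s i) = (⋃ i ∈ F, s i) ∧
      (G : Set ι).PairwiseDisjoint s by
    obtain ⟨G, hGF, hU, hd⟩ := H
    rw [← hU, measure_biUnion_finset hd (fun i _ => hm i),
      measure_biUnion_finset hd (fun i _ => hm i)]
    exact Finset.sum_le_sum fun i hi => h i (hGF hi)
  clear h
  induction F using Finset.induction_on with
  | empty => exact ⟨∅, by simp⟩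
  | insert a F ha ih =>
    obtain ⟨G, hGF, hU, hd⟩ := ih
    by_cases hsub : ∃ j ∈ G, s a ⊆ s j
    · obtain ⟨j, hj, hsub⟩ := hsub
      refine ⟨G, hGF.trans (Finset.subset_insert _ _), ?_, hd⟩
      rw [Finset.set_biUnion_insert, ← hU, eq_comm, Set.union_eq_right]
      exact hsub.trans (Set.subset_biUnion_of_mem (u := s) hj)
    · push Not at hsub
      -- By laminarity, the discarded members of `G` lie inside `s a`, so the union does not change.
      refine ⟨insert a (G.filter fun j => Disjoint (s a) (s j)), ?_, ?_, ?_⟩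
      · exact Finset.insert_subset_insert _ ((Finset.filter_subset _ _).trans hGF)
      · rw [Finset.set_biUnion_insert, Finset.set_biUnion_insert, ← hU]
        apply Set.Subset.antisymm
        · exact Set.union_subset_union_right _
            (Set.biUnion_subset_biUnion_left (Finset.filter_subset _ _))
        · refine Set.union_subset Set.subset_union_left (Set.iUnion₂_subset fun j hj => ?_)
          rcases hs a j with h | h | h
          · exact absurd h (hsub j hj)
          · exact h.trans Set.subset_union_left
          · exact (Set.subset_biUnion_of_mem (u := s)
              (Finset.mem_filter.2 ⟨hj, h⟩ : j ∈ (G.filter fun j => Disjoint (s a) (s j)))).trans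
              Set.subset_union_right
      · rw [Finset.coe_insert]
        refine (hd.subset ?_).insert fun j hj _ => ?_
        · exact Finset.coe_subset.2 (Finset.filter_subset _ _)
        · exact (Finset.mem_filter.1 (Finset.mem_coe.1 hj)).2

/-- The sum of the geometric series with ratio `2⁻ʳ`. -/
noncomputable def geomConst (r : ℝ) : ℝ≥0∞ := (1 - (2 : ℝ≥0∞)⁻¹ ^ r)⁻¹

theorem geomConst_ne_top {r : ℝ} (hr : 0 < r) : geomConst r ≠ ∞ := by
  have h : (2 : ℝ≥0∞)⁻¹ ^ r < 1 := ENNReal.rpow_lt_one (by simp) hr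
  simp only [geomConst, ne_eq, ENNReal.inv_eq_top]
  exact (tsub_pos_of_lt h).ne'

theorem geomConst_eq (r : ℝ) : 1 + (2 : ℝ≥0∞)⁻¹ ^ r * geomConst r = geomConst r := by
  have h := tsum_eq_zero_add' (f := fun n : ℕ => ((2 : ℝ≥0∞)⁻¹ ^ r) ^ n) ENNReal.summable
  simp only [pow_zero, pow_succ', ENNReal.tsum_mul_left, ENNReal.tsum_geometric] at h
  exact h.symm

/-- A sum of powers of numbers that pairwise differ by a factor of at least two is comparable to
its largest term. -/
theorem sum_rpow_le_of_separated {ι : Type*} {r : ℝ} (hr : 0 < r) (b : ι → ℝ≥0∞)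
    (T : Finset ι) (hT : ∀ i ∈ T, ∀ j ∈ T, i ≠ j → 2 * b i ≤ b j ∨ 2 * b j ≤ b i)
    (M : ℝ≥0∞) (hM : ∀ i ∈ T, b i ≤ M) :
    ∑ i ∈ T, b i ^ r ≤ geomConst r * M ^ r := by
  classical
  induction T using Finset.strongInduction generalizing M with
  | H T ih =>
    rcases T.eq_empty_or_nonempty with rfl | hne
    · simp
    obtain ⟨i₀, hi₀, hmax⟩ := T.exists_max_image b hne
    have hrest : ∀ i ∈ T.erase i₀, b i ≤ 2⁻¹ * b i₀ := by
      intro i hi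
      obtain ⟨hne, hi⟩ := Finset.mem_erase.1 hi
      have h2 : 2 * b i ≤ b i₀ := by
        rcases hT i hi i₀ hi₀ hne with h | h
        · exact h
        -- Here 2 b i₀ ≤ b i ≤ b i₀, which is possible only for the values 0 and ∞.
        · have h3 := hmax i hi
          exact (mul_le_mul_right h3 2).trans (h.trans h3)
      calc b i = 2⁻¹ * (2 * b i) := by
            rw [← mul_assoc, ENNReal.inv_mul_cancel (by simp) (by simp), one_mul]
        _ ≤ _ := mul_le_mul_right h2 _
    have := ih (T.erase i₀) (Finset.erase_ssubset hi₀)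
      (fun i hi j hj => hT i (Finset.mem_of_mem_erase hi) j (Finset.mem_of_mem_erase hj)) _ hrest
    rw [← Finset.add_sum_erase T _ hi₀]
    calc b i₀ ^ r + ∑ i ∈ T.erase i₀, b i ^ r
        ≤ b i₀ ^ r + geomConst r * (2⁻¹ * b i₀) ^ r := by gcongr
      _ = (1 + 2⁻¹ ^ r * geomConst r) * b i₀ ^ r := by
          rw [ENNReal.mul_rpow_of_nonneg _ _ hr.le]; ring
      _ = geomConst r * b i₀ ^ r := by rw [geomConst_eq]
      _ ≤ geomConst r * M ^ r := by gcongr; exact hM i₀ hi₀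

variable {ι X : Type*} [MeasurableSpace X]

/-- The average of `φ` over `s`. -/
noncomputable def avg (μ : Measure X) (φ : X → ℝ≥0∞) (s : Set X) : ℝ≥0∞ :=
  (∫⁻ x in s, φ x ∂μ) / μ s

theorem avg_mul_measure {μ : Measure X} {φ : X → ℝ≥0∞} {s : Set X} (h0 : μ s ≠ 0) (ht : μ s ≠ ∞) :
    avg μ φ s * μ s = ∫⁻ x in s, φ x ∂μ :=
  ENNReal.div_mul_cancel h0 ht

/-- Jensen's inequality for averages. -/
theorem avg_rpow_mul_measure_le {μ : Measure X} {φ : X → ℝ≥0∞} (hφ : AEMeasurable φ μ) {p : ℝ}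
    (hp : 1 < p) {s : Set X} (h0 : μ s ≠ 0) (ht : μ s ≠ ∞) :
    avg μ φ s ^ p * μ s ≤ ∫⁻ x, φ x ^ p ∂μ := by
  have hpq := Real.HolderConjugate.conjExponent hp
  have h := ENNReal.lintegral_mul_le_Lp_mul_Lq (μ.restrict s) hpq hφ.restrict
    (aemeasurable_const (b := (1 : ℝ≥0∞)))
  simp only [Pi.mul_apply, mul_one, ENNReal.one_rpow, lintegral_one,
    Measure.restrict_apply_univ] at h
  have hp0 : 0 < p := by linarith
  have h1 : (∫⁻ x in s, φ x ∂μ) ^ p ≤ (∫⁻ x in s, φ x ^ p ∂μ) * μ s ^ (p - 1) := by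
    refine (ENNReal.rpow_le_rpow h hp0.le).trans_eq ?_
    rw [ENNReal.mul_rpow_of_nonneg _ _ hp0.le, ← ENNReal.rpow_mul, ← ENNReal.rpow_mul,
      one_div_mul_cancel hp0.ne', ENNReal.rpow_one]
    congr 2
    rw [Real.conjExponent]
    field_simp
  rw [avg, ENNReal.div_rpow_of_nonneg _ _ hp0.le]
  calc (∫⁻ x in s, φ x ∂μ) ^ p / μ s ^ p * μ s
      ≤ ((∫⁻ x in s, φ x ^ p ∂μ) * μ s ^ (p - 1)) / μ s ^ p * μ s := by gcongr
    _ = (∫⁻ x in s, φ x ^ p ∂μ) * (μ s ^ (p - 1) * μ s ^ (1 : ℝ) * (μ s ^ p)⁻¹) := by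
        rw [ENNReal.rpow_one, div_eq_mul_inv]; ring
    _ = ∫⁻ x in s, φ x ^ p ∂μ := by
        rw [← ENNReal.rpow_add _ _ h0 ht, sub_add_cancel, ENNReal.mul_inv_cancel, mul_one]
        · simp [hp0.not_gt, h0, ht]
        · simp [hp0.not_gt, h0, ht]
    _ ≤ _ := setLIntegral_le_lintegral _ _

end

/-! ### The Carleson embedding theorem -/

section

variable {ι X : Type*} [MeasurableSpace X]

/-- Jensen's inequality excludes an infinite average. Finiteness is what later permits dividing by a
power of the sum being estimated. -/
theorem avg_ne_top {μ : Measure X} {φ : X → ℝ≥0∞} (hφ : AEMeasurable φ μ) {p : ℝ}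
    (hp : 1 < p) (hN : ∫⁻ x, φ x ^ p ∂μ ≠ ∞) {s : Set X} (h0 : μ s ≠ 0) (ht : μ s ≠ ∞) :
    avg μ φ s ≠ ∞ := by
  intro h
  have h1 := avg_rpow_mul_measure_le hφ hp h0 ht
  rw [h, ENNReal.top_rpow_of_pos (by linarith), ENNReal.top_mul h0, top_le_iff] at h1
  exact hN h1

/-- The embedding inequality for families whose averages at least double along inclusions. -/
theorem sum_avg_rpow_le_of_separated {s : ι → Set X} (hs : Laminar s)
    (hm : ∀ i, MeasurableSet (s i)) {μ : Measure X} {φ : X → ℝ≥0∞} (hφ : AEMeasurable φ μ)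
    {p : ℝ} (hp : 1 < p) (hN : ∫⁻ x, φ x ^ p ∂μ ≠ ∞) (T : Finset ι)
    (h0 : ∀ i ∈ T, μ (s i) ≠ 0) (ht : ∀ i ∈ T, μ (s i) ≠ ∞)
    (hsep : ∀ i ∈ T, ∀ j ∈ T, i ≠ j → s i ⊆ s j → 2 * avg μ φ (s j) < avg μ φ (s i)) :
    ∑ i ∈ T, avg μ φ (s i) ^ p * μ (s i) ≤ geomConst (p - 1) ^ p * ∫⁻ x, φ x ^ p ∂μ := by
  classical
  have hp0 : 0 < p := by linarith
  have hr : 0 < p - 1 := by linarith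
  set b : ι → ℝ≥0∞ := fun i => avg μ φ (s i) with hb
  set C := geomConst (p - 1) with hC
  set Y := ∑ i ∈ T, b i ^ p * μ (s i) with hY
  set N := ∫⁻ x, φ x ^ p ∂μ with hNdef
  have hpq := Real.HolderConjugate.conjExponent hp
  set p' := p.conjExponent with hp'
  have hp'0 : 0 < p' := hpq.symm.pos
  have hbt : ∀ i ∈ T, b i ≠ ∞ := fun i hi => avg_ne_top hφ hp hN (h0 i hi) (ht i hi)
  have hYt : Y ≠ ∞ := by
    refine ENNReal.sum_ne_top.2 fun i hi => ENNReal.mul_ne_top ?_ (ht i hi)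
    exact ENNReal.rpow_ne_top_of_nonneg hp0.le (hbt i hi)
  -- The dual function: the sum equals ∫ φ g, to which Hölder's inequality applies, so no maximal
  -- theorem is needed.
  set g : X → ℝ≥0∞ := fun x => ∑ i ∈ T, (s i).indicator (fun _ => b i ^ (p - 1)) x with hg
  have hgm : Measurable g :=
    Finset.measurable_fun_sum _ fun i _ => measurable_const.indicator (hm i)
  -- The sets through `x` form a chain, so their averages are separated by factors of two and the
  -- sum is comparable to its largest term; then p'(p - 1) = p.
  have hpt : ∀ x, g x ^ p' ≤ C ^ p' * ∑ i ∈ T, (s i).indicator (fun _ => b i ^ p) x := by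
    intro x
    set Tx := T.filter fun i => x ∈ s i with hTx
    have hsum : ∀ e : ℝ, ∑ i ∈ T, (s i).indicator (fun _ => b i ^ e) x = ∑ i ∈ Tx, b i ^ e := by
      intro e
      rw [Finset.sum_filter]
      exact Finset.sum_congr rfl fun i _ => by simp [Set.indicator_apply]
    simp only [hg]
    rw [hsum, hsum]
    rcases Tx.eq_empty_or_nonempty with he | hne
    · simp [he, hp'0]
    obtain ⟨i₀, hi₀, hmax⟩ := Tx.exists_max_image b hne
    have hgeom := sum_rpow_le_of_separated hr b Tx ?_ (b i₀) hmax
    · calc (∑ i ∈ Tx, b i ^ (p - 1)) ^ p' ≤ (C * b i₀ ^ (p - 1)) ^ p' := by gcongr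
        _ = C ^ p' * b i₀ ^ p := by
            rw [ENNReal.mul_rpow_of_nonneg _ _ hp'0.le, ← ENNReal.rpow_mul]
            congr 2
            rw [hp', Real.conjExponent]
            field_simp
        _ ≤ _ := by
            gcongr
            exact Finset.single_le_sum (f := fun i => b i ^ p) (fun _ _ => zero_le) hi₀
    · intro i hi j hj hij
      obtain ⟨hi, hxi⟩ := Finset.mem_filter.1 hi
      obtain ⟨hj, hxj⟩ := Finset.mem_filter.1 hj
      rcases hs i j with h | h | h
      · exact Or.inr (hsep i hi j hj hij h).le
      · exact Or.inl (hsep j hj i hi hij.symm h).le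
      · exact absurd hxj (Set.disjoint_left.1 h hxi)
  have hgint : ∫⁻ x, g x ^ p' ∂μ ≤ C ^ p' * Y := by
    refine (lintegral_mono hpt).trans_eq ?_
    rw [lintegral_const_mul _ (Finset.measurable_fun_sum _ fun i _ =>
        measurable_const.indicator (hm i)),
      lintegral_finsetSum _ fun i _ => measurable_const.indicator (hm i)]
    simp_rw [lintegral_indicator_const (hm _)]
    rfl
  have hYeq : Y = ∫⁻ x, (φ * g) x ∂μ := by
    simp only [Pi.mul_apply, hg, Finset.mul_sum]
    rw [lintegral_finsetSum' T (f := fun i x => φ x * (s i).indicator (fun _ => b i ^ (p - 1)) x)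
      fun i _ => hφ.mul (measurable_const.indicator (hm i)).aemeasurable]
    refine Finset.sum_congr rfl fun i hi => ?_
    have : ∀ x, φ x * (s i).indicator (fun _ => b i ^ (p - 1)) x
        = (s i).indicator (fun x => φ x * b i ^ (p - 1)) x := fun x => by
      simp [Set.indicator_apply]
    simp_rw [this]
    rw [lintegral_indicator (hm i), lintegral_mul_const'' _ hφ.restrict,
      ← avg_mul_measure (h0 i hi) (ht i hi)]
    have hsplit : b i ^ p = b i * b i ^ (p - 1) := by
      conv_lhs => rw [show p = 1 + (p - 1) by ring]
      rw [ENNReal.rpow_add_of_nonneg _ _ zero_le_one hr.le, ENNReal.rpow_one]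
    rw [hsplit]
    simp only [hb]
    ring
  have hkey : Y ≤ N ^ (1 / p) * (C * Y ^ (1 / p')) := by
    calc Y = _ := hYeq
      _ ≤ _ := ENNReal.lintegral_mul_le_Lp_mul_Lq μ hpq hφ hgm.aemeasurable
      _ ≤ N ^ (1 / p) * (C ^ p' * Y) ^ (1 / p') := by gcongr
      _ = _ := by
        rw [ENNReal.mul_rpow_of_nonneg _ _ (by positivity), ← ENNReal.rpow_mul,
          mul_one_div_cancel hp'0.ne', ENNReal.rpow_one]
  rcases eq_or_ne Y 0 with hY0 | hY0
  · rw [hY0]; exact zero_le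
  have hsum1 : 1 / p + 1 / p' = 1 := by simpa using hpq.inv_add_inv_eq_one
  have h2 : Y ^ (1 / p) ≤ C * N ^ (1 / p) := by
    have hne : Y ^ (1 / p') ≠ 0 := by simp [hY0, hYt]
    have hnt : Y ^ (1 / p') ≠ ∞ := ENNReal.rpow_ne_top_of_nonneg (by positivity) hYt
    rw [← ENNReal.mul_le_mul_iff_left hne hnt, ← ENNReal.rpow_add _ _ hY0 hYt, hsum1,
      ENNReal.rpow_one]
    exact hkey.trans_eq (by ring)
  calc Y = (Y ^ (1 / p)) ^ p := by
        rw [← ENNReal.rpow_mul, one_div_mul_cancel hp0.ne', ENNReal.rpow_one]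
    _ ≤ (C * N ^ (1 / p)) ^ p := by gcongr
    _ = C ^ p * N := by
        rw [ENNReal.mul_rpow_of_nonneg _ _ hp0.le, ← ENNReal.rpow_mul,
          one_div_mul_cancel hp0.ne', ENNReal.rpow_one]

/-- The Carleson embedding theorem for finite laminar families. -/
theorem carleson_embedding {s : ι → Set X} (hs : Laminar s) (hinj : Function.Injective s)
    (hm : ∀ i, MeasurableSet (s i)) {μ : Measure X} {φ : X → ℝ≥0∞} (hφ : AEMeasurable φ μ)
    {p : ℝ} (hp : 1 < p) (hN : ∫⁻ x, φ x ^ p ∂μ ≠ ∞) (F : Finset ι)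
    (h0 : ∀ i ∈ F, μ (s i) ≠ 0) (ht : ∀ i ∈ F, μ (s i) ≠ ∞) {A : ℝ≥0∞}
    (hA : ∀ i ∈ F, ∀ G ⊆ F, (∀ j ∈ G, s j ⊆ s i) → ∑ j ∈ G, μ (s j) ≤ A * μ (s i)) :
    ∑ i ∈ F, avg μ φ (s i) ^ p * μ (s i)
      ≤ 2 ^ p * A * geomConst (p - 1) ^ p * ∫⁻ x, φ x ^ p ∂μ := by
  classical
  have hp0 : 0 < p := by linarith
  obtain ⟨T, hTF, hcov, hsep⟩ := exists_principal hinj (fun i => avg μ φ (s i)) F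
  have hT := sum_avg_rpow_le_of_separated hs hm hφ hp hN T (fun i hi => h0 i (hTF hi))
    (fun i hi => ht i (hTF hi)) hsep
  -- Grouping by principal set costs 2^p for the averages and `A` for the total measure of each
  -- group.
  choose! π hπT hπsub hπavg using hcov
  calc ∑ i ∈ F, avg μ φ (s i) ^ p * μ (s i)
      = ∑ j ∈ T, ∑ i ∈ F with π i = j, avg μ φ (s i) ^ p * μ (s i) :=
        (Finset.sum_fiberwise_of_maps_to hπT _).symm
    _ ≤ ∑ j ∈ T, 2 ^ p * A * (avg μ φ (s j) ^ p * μ (s j)) := by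
        refine Finset.sum_le_sum fun j hj => ?_
        calc ∑ i ∈ F with π i = j, avg μ φ (s i) ^ p * μ (s i)
            ≤ ∑ i ∈ F with π i = j, (2 * avg μ φ (s j)) ^ p * μ (s i) := by
              refine Finset.sum_le_sum fun i hi => ?_
              obtain ⟨hiF, rfl⟩ := Finset.mem_filter.1 hi
              gcongr
              exact hπavg i hiF
          _ = (2 * avg μ φ (s j)) ^ p * ∑ i ∈ F with π i = j, μ (s i) :=
              (Finset.mul_sum _ _ _).symm
          _ ≤ (2 * avg μ φ (s j)) ^ p * (A * μ (s j)) := by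
              gcongr
              refine hA j (hTF hj) _ (Finset.filter_subset _ _) fun i hi => ?_
              obtain ⟨hiF, rfl⟩ := Finset.mem_filter.1 hi
              exact hπsub i hiF
          _ = _ := by rw [ENNReal.mul_rpow_of_nonneg _ _ hp0.le]; ring
    _ = 2 ^ p * A * ∑ j ∈ T, avg μ φ (s j) ^ p * μ (s j) := (Finset.mul_sum _ _ _).symm
    _ ≤ 2 ^ p * A * (geomConst (p - 1) ^ p * ∫⁻ x, φ x ^ p ∂μ) := by gcongr
    _ = _ := by ring

end

/-! ### Sparseness of principal sets -/

section

variable {ι X : Type*} [MeasurableSpace X]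

/-- The part of `s i` not covered by the smaller members of the family `S`. -/
def ownPart (s : ι → Set X) (S : Finset ι) (i : ι) : Set X :=
  s i \ ⋃ j ∈ S, ⋃ (_ : j ≠ i ∧ s j ⊆ s i), s j

theorem measurableSet_ownPart {s : ι → Set X} (hm : ∀ i, MeasurableSet (s i)) (S : Finset ι)
    (i : ι) : MeasurableSet (ownPart s S i) :=
  (hm i).diff <| S.measurableSet_biUnion fun j _ => MeasurableSet.iUnion fun _ => hm j


theorem pairwiseDisjoint_ownPart {ι X : Type*} {s : ι → Set X} (hs : Laminar s) (S : Finset ι) :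
    (S : Set ι).PairwiseDisjoint (ownPart s S) := by
  have key : ∀ i ∈ S, ∀ j, i ≠ j → s i ⊆ s j → Disjoint (ownPart s S i) (ownPart s S j) := by
    intro i hi j hij hsub
    refine Set.disjoint_left.2 fun x hx hx' => hx'.2 ?_
    simp only [Set.mem_iUnion]
    exact ⟨i, hi, ⟨hij, hsub⟩, hx.1⟩
  intro i hi j hj hij
  rcases hs i j with h | h | h
  · exact key i hi j hij h
  · exact (key j hj i hij.symm h).symm
  · exact h.mono Set.sdiff_subset Set.sdiff_subset

/-- Principal sets for fractional averages form a sparse family. -/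
theorem measure_le_two_mul_ownPart {s : ι → Set X} (hs : Laminar s)
    (hm : ∀ i, MeasurableSet (s i)) {v μ : Measure X} {φ : X → ℝ≥0∞}
    {e : ℝ} (he0 : 0 < e) (he1 : e ≤ 1) (S : Finset ι)
    (h0 : ∀ i, v (s i) ≠ 0) (ht : ∀ i, v (s i) ≠ ∞)
    (hsep : ∀ i ∈ S, ∀ j ∈ S, i ≠ j → s i ⊆ s j →
      2 * ((∫⁻ x in s j, φ x ∂μ) / v (s j) ^ e) < (∫⁻ x in s i, φ x ∂μ) / v (s i) ^ e)
    {i : ι} (hi : i ∈ S) :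
    v (s i) ≤ 2 * v (ownPart s S i) := by
  classical
  set l : ι → ℝ≥0∞ := fun i => (∫⁻ x in s i, φ x ∂μ) / v (s i) ^ e with hl
  have hmul : ∀ j, l j * v (s j) = v (s j) ^ (1 - e) * ∫⁻ x in s j, φ x ∂μ := by
    intro j
    have h1 : v (s j) = v (s j) ^ (1 - e) * v (s j) ^ e := by
      rw [← ENNReal.rpow_add _ _ (h0 j) (ht j), sub_add_cancel, ENNReal.rpow_one]
    have hne : v (s j) ^ e ≠ 0 := by simp [h0 j, ht j]
    have hnt : v (s j) ^ e ≠ ∞ := ENNReal.rpow_ne_top_of_nonneg he0.le (ht j)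
    calc l j * v (s j) = l j * (v (s j) ^ (1 - e) * v (s j) ^ e) := by rw [← h1]
      _ = v (s j) ^ (1 - e) * (l j * v (s j) ^ e) := by ring
      _ = _ := by rw [hl]; simp only; rw [ENNReal.div_mul_cancel hne hnt]
  set G := S.filter fun j => j ≠ i ∧ s j ⊆ s i with hG
  set U := ⋃ j ∈ G, s j with hU
  have hUi : U ⊆ s i := Set.iUnion₂_subset fun j hj => (Finset.mem_filter.1 hj).2.2
  have hUm : MeasurableSet U := G.measurableSet_biUnion fun j _ => hm j
  have hown : ownPart s S i = s i \ U := by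
    rw [ownPart, hU]
    congr 1
    ext x
    simp only [hG, Set.mem_iUnion, Finset.mem_filter, exists_prop]
    exact exists_congr fun j => by tauto
  have hsplit : v (s i) = v U + v (ownPart s S i) := by
    rw [hown, add_comm, ← measure_sdiff_add_inter (s i) hUm, Set.inter_eq_self_of_subset_right hUi]
  rcases G.eq_empty_or_nonempty with he | ⟨j₀, hj₀⟩
  · have : U = ∅ := by simp [hU, he]
    rw [hsplit, this, measure_empty, zero_add, two_mul]
    exact le_self_add
  have hlt : ∀ j ∈ G, 2 * l i < l j := fun j hj => by
    obtain ⟨hjS, hji, hsub⟩ := Finset.mem_filter.1 hj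
    exact hsep j hjS i hi hji hsub
  -- Finiteness and positivity of `l i` both come from the strict inequality at the nested set `j₀`;
  -- they allow `l i` to be cancelled at the end.
  have hlt0 : l i ≠ ∞ := by
    intro h
    have := hlt j₀ hj₀
    rw [h, ENNReal.mul_top two_ne_zero] at this
    exact not_top_lt this
  have hl0 : l i ≠ 0 := by
    intro h
    have h1 := hmul i
    rw [h, zero_mul, eq_comm, mul_eq_zero] at h1
    have h2 : ∫⁻ x in s i, φ x ∂μ = 0 := by
      rcases h1 with h1 | h1
      · exact absurd h1 (by simp [h0 i, ht i])
      · exact h1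
    have h3 : ∫⁻ x in s j₀, φ x ∂μ = 0 :=
      le_antisymm ((lintegral_mono_set (Finset.mem_filter.1 hj₀).2.2).trans h2.le) zero_le
    have := hlt j₀ hj₀
    simp [hl, h3] at this
  -- On each smaller set, doubling and v(s j)^{1-e} ≤ v(s i)^{1-e} (here e ≤ 1 enters) compare these
  -- two measures. On the union this yields 2 l(i) v(U) ≤ l(i) v(s i).
  have hunion := hs.measure_biUnion_le hm (μ := (2 * l i) • v)
    (ν := (v (s i) ^ (1 - e)) • μ.withDensity φ) G fun j hj => by
      simp only [Measure.smul_apply, smul_eq_mul, withDensity_apply _ (hm j)]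
      calc 2 * l i * v (s j) ≤ l j * v (s j) := by gcongr; exact (hlt j hj).le
        _ = _ := hmul j
        _ ≤ _ := by
          have : 0 ≤ 1 - e := by linarith
          gcongr
          exact (Finset.mem_filter.1 hj).2.2
  simp only [Measure.smul_apply, smul_eq_mul, ← hU, withDensity_apply _ hUm] at hunion
  have h4 : l i * (2 * v U) ≤ l i * v (s i) := by
    rw [hmul i]
    calc l i * (2 * v U) = 2 * l i * v U := by ring
      _ ≤ _ := hunion
      _ ≤ _ := by gcongr
  have h5 : 2 * v U ≤ v (s i) := (ENNReal.mul_le_mul_iff_right hl0 hlt0).1 h4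
  have hUt : v U ≠ ∞ := ((measure_mono hUi).trans_lt (ht i).lt_top).ne
  have h6 : v U ≤ v (ownPart s S i) := by
    rw [hsplit, two_mul] at h5
    exact (ENNReal.add_le_add_iff_left hUt).1 h5
  calc v (s i) = v U + v (ownPart s S i) := hsplit
    _ ≤ v (ownPart s S i) + v (ownPart s S i) := by gcongr
    _ = _ := (two_mul _).symm

/-! ### Cubes, weights, the ratio ρ and packing -/

variable {n : ℕ}

theorem Cube.measurableSet (Q : Cube n) : MeasurableSet Q.toSet :=
  MeasurableSet.univ_pi fun _ => measurableSet_Ico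

theorem Cube.volume_eq (Q : Cube n) : volume Q.toSet = ENNReal.ofReal Q.side ^ n := by
  simp [Cube.toSet, volume_pi_pi]

theorem Cube.volume_ne_zero (Q : Cube n) : volume Q.toSet ≠ 0 := by
  rw [Q.volume_eq]
  exact pow_ne_zero _ (by simpa using Q.side_pos)

theorem Cube.volume_ne_top (Q : Cube n) : volume Q.toSet ≠ ∞ := by
  rw [Q.volume_eq]
  exact ENNReal.pow_ne_top ENNReal.ofReal_ne_top

theorem Cube.subset_Icc (Q : Cube n) :
    Q.toSet ⊆ Set.Icc Q.corner (fun i => Q.corner i + Q.side) := by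
  intro x hx
  have := fun i => hx i (Set.mem_univ i)
  exact ⟨fun i => (this i).1, fun i => (this i).2.le⟩

theorem IsWeight.aemeasurable {σ : (Fin n → ℝ) → ℝ} (hσ : IsWeight σ) :
    AEMeasurable (fun x => ENNReal.ofReal (σ x)) volume :=
  hσ.locallyIntegrable.aestronglyMeasurable.aemeasurable.ennreal_ofReal

theorem wMeasure_apply (σ : (Fin n → ℝ) → ℝ) (Q : Cube n) :
    wMeasure σ Q.toSet = ∫⁻ x in Q.toSet, ENNReal.ofReal (σ x) :=
  withDensity_apply _ Q.measurableSet

theorem IsWeight.enorm_eq {σ : (Fin n → ℝ) → ℝ} (hσ : IsWeight σ) (x : Fin n → ℝ) :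
    ‖σ x‖ₑ = ENNReal.ofReal (σ x) := by
  rw [← ofReal_norm, Real.norm_of_nonneg (hσ.nonneg x)]

theorem IsWeight.wMeasure_ne_top {σ : (Fin n → ℝ) → ℝ} (hσ : IsWeight σ) (Q : Cube n) :
    wMeasure σ Q.toSet ≠ ∞ := by
  have h : IntegrableOn σ Q.toSet :=
    (hσ.locallyIntegrable.integrableOn_isCompact isCompact_Icc).mono_set Q.subset_Icc
  rw [wMeasure_apply]
  simp_rw [← hσ.enorm_eq]
  exact h.2.ne

/-- On a cube `Q ⊆ R` the maximal function of `σ 1_R` is at least the mean of `σ` over `Q`. -/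
theorem IsWeight.mean_le_hlMaximal {σ : (Fin n → ℝ) → ℝ} (hσ : IsWeight σ) {Q R : Cube n}
    (hQR : Q.toSet ⊆ R.toSet) {x : Fin n → ℝ} (hx : x ∈ Q.toSet) :
    wMeasure σ Q.toSet / volume Q.toSet ≤ hlMaximal (R.toSet.indicator σ) x := by
  refine le_trans (le_of_eq ?_) (le_iSup₂ (f := fun (Q : Cube n) (_ : x ∈ Q.toSet) =>
    (∫⁻ y in Q.toSet, ‖R.toSet.indicator σ y‖ₑ) / volume Q.toSet ^ (1 - 0 / (n : ℝ))) Q hx)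
  rw [zero_div, sub_zero, ENNReal.rpow_one, wMeasure_apply]
  congr 1
  refine setLIntegral_congr_fun Q.measurableSet fun y hy => ?_
  simp only [Set.indicator_of_mem (hQR hy), hσ.enorm_eq]

theorem IsWeight.measure_le_setLIntegral_hlMaximal {σ : (Fin n → ℝ) → ℝ} (hσ : IsWeight σ)
    (Q : Cube n) :
    wMeasure σ Q.toSet ≤ ∫⁻ x in Q.toSet, hlMaximal (Q.toSet.indicator σ) x := by
  calc wMeasure σ Q.toSet = wMeasure σ Q.toSet / volume Q.toSet * volume Q.toSet :=
        (ENNReal.div_mul_cancel Q.volume_ne_zero Q.volume_ne_top).symm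
    _ = ∫⁻ _ in Q.toSet, wMeasure σ Q.toSet / volume Q.toSet := by
        rw [setLIntegral_const]
    _ ≤ _ := setLIntegral_mono' Q.measurableSet fun x hx => hσ.mean_le_hlMaximal subset_rfl hx

/-- On `Q` the maximal function dominates the constant mean of σ. This bound gives every cube a
dyadic level k ≥ 0 and yields ρ ≤ ρ^{q/p}. -/
theorem IsWeight.one_le_rho {σ : (Fin n → ℝ) → ℝ} (hσ : IsWeight σ) {Q : Cube n}
    (h0 : wMeasure σ Q.toSet ≠ 0) : 1 ≤ rho σ Q := by
  rw [rho, ENNReal.le_div_iff_mul_le (Or.inl h0) (Or.inl (hσ.wMeasure_ne_top Q)), one_mul]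
  exact hσ.measure_le_setLIntegral_hlMaximal Q

theorem IsWeight.rho_mul {σ : (Fin n → ℝ) → ℝ} (hσ : IsWeight σ) {Q : Cube n}
    (h0 : wMeasure σ Q.toSet ≠ 0) :
    rho σ Q * wMeasure σ Q.toSet = ∫⁻ x in Q.toSet, hlMaximal (Q.toSet.indicator σ) x :=
  ENNReal.div_mul_cancel h0 (hσ.wMeasure_ne_top Q)

/-- The packing estimate for sparse families of cubes inside a cube `R`. -/
theorem IsWeight.sum_measure_le {σ : (Fin n → ℝ) → ℝ} (hσ : IsWeight σ) {Q : ι → Cube n}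
    (hs : Laminar fun i => (Q i).toSet) {S : Finset ι}
    (hS : ∀ i ∈ S, volume (Q i).toSet ≤ 2 * volume (ownPart (fun i => (Q i).toSet) S i))
    (R : Cube n) {G : Finset ι} (hGS : G ⊆ S) (hGR : ∀ i ∈ G, (Q i).toSet ⊆ R.toSet) :
    ∑ i ∈ G, wMeasure σ (Q i).toSet
      ≤ 2 * ∫⁻ x in R.toSet, hlMaximal (R.toSet.indicator σ) x := by
  set E := ownPart (fun i => (Q i).toSet) S with hE
  have hEQ : ∀ i, E i ⊆ (Q i).toSet := fun i => Set.sdiff_subset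
  have hEm : ∀ i, MeasurableSet (E i) :=
    measurableSet_ownPart (s := fun i => (Q i).toSet) (fun i => (Q i).measurableSet) S
  have hd : (G : Set ι).PairwiseDisjoint E :=
    (pairwiseDisjoint_ownPart hs S).subset (Finset.coe_subset.2 hGS)
  calc ∑ i ∈ G, wMeasure σ (Q i).toSet
      ≤ ∑ i ∈ G, 2 * ∫⁻ x in E i, hlMaximal (R.toSet.indicator σ) x := by
        -- Write σ(Q) as mean times volume and trade |Q| for 2|E(Q)|; on E(Q) the mean is below M(σ
        -- 1_R).
        refine Finset.sum_le_sum fun i hi => ?_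
        calc wMeasure σ (Q i).toSet
            = wMeasure σ (Q i).toSet / volume (Q i).toSet * volume (Q i).toSet :=
              (ENNReal.div_mul_cancel (Q i).volume_ne_zero (Q i).volume_ne_top).symm
          _ ≤ wMeasure σ (Q i).toSet / volume (Q i).toSet * (2 * volume (E i)) := by
              gcongr; exact hS i (hGS hi)
          _ = 2 * ∫⁻ _ in E i, wMeasure σ (Q i).toSet / volume (Q i).toSet := by
              rw [setLIntegral_const]; ring
          _ ≤ _ := by
              gcongr 2 * ?_
              exact setLIntegral_mono' (hEm i) fun x hx =>
                hσ.mean_le_hlMaximal (hGR i hi) (hEQ i hx)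
    _ = 2 * ∫⁻ x in ⋃ i ∈ G, E i, hlMaximal (R.toSet.indicator σ) x := by
        rw [lintegral_biUnion_finset hd fun i _ => hEm i, Finset.mul_sum]
    _ ≤ _ := by
        gcongr 2 * ?_
        exact lintegral_mono_set (Set.iUnion₂_subset fun i hi => (hEQ i).trans (hGR i hi))

end

/-! ### The one-bump estimate for sparse families -/

section

/-- The dyadic form of the integral condition on `ε`. -/
theorem tsum_inv_eps_le {ε : ℝ → ℝ} (hε : MonotoneOn ε (Set.Ici 1)) {c q : ℝ} (hc : 0 < c)
    (hcε : c ≤ ε 1) (hq : 0 < q)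
    (hint : (∫⁻ t in Set.Ioi (1 : ℝ), ENNReal.ofReal (1 / (t * ε t ^ q))) = 1) :
    ∑' k : ℕ, (ENNReal.ofReal (ε (2 ^ k)) ^ q)⁻¹ ≤ (ENNReal.ofReal c ^ q)⁻¹ + 2 := by
  have hpos : ∀ t : ℝ, 1 ≤ t → 0 < ε t := fun t ht =>
    hc.trans_le (hcε.trans (hε Set.self_mem_Ici ht ht))
  -- Monotonicity compares term k + 1 with the integral over (2^k, 2^{k+1}], whose length is half
  -- its right endpoint: hence the factor 2. The term k = 0 has no interval to its left and is
  -- bounded through `c`.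
  rw [tsum_eq_zero_add' ENNReal.summable]
  refine add_le_add ?_ ?_
  · rw [pow_zero]
    gcongr
  set I : ℕ → Set ℝ := fun k => Set.Ioc ((2 : ℝ) ^ k) (2 ^ (k + 1)) with hI
  have hd : Pairwise (Function.onFun Disjoint I) :=
    Monotone.pairwise_disjoint_on_Ioc_succ (f := fun k : ℕ => (2 : ℝ) ^ k)
      (pow_right_mono₀ (one_le_two))
  have hsub : (⋃ k, I k) ⊆ Set.Ioi 1 := Set.iUnion_subset fun k t ht =>
    (one_le_pow₀ (one_le_two (α := ℝ))).trans_lt ht.1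
  have hterm : ∀ k, (ENNReal.ofReal (ε (2 ^ (k + 1))) ^ q)⁻¹
      ≤ 2 * ∫⁻ t in I k, ENNReal.ofReal (1 / (t * ε t ^ q)) := by
    intro k
    have h2 : (1 : ℝ) ≤ 2 ^ (k + 1) := one_le_pow₀ one_le_two
    have hE := hpos _ h2
    have hle : ∫⁻ _ in I k, ENNReal.ofReal (1 / (2 ^ (k + 1) * ε (2 ^ (k + 1)) ^ q))
        ≤ ∫⁻ t in I k, ENNReal.ofReal (1 / (t * ε t ^ q)) := by
      refine setLIntegral_mono' measurableSet_Ioc fun t ht => ENNReal.ofReal_le_ofReal ?_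
      have ht1 : 1 < t := hsub (Set.mem_iUnion.2 ⟨k, ht⟩)
      have h3 := hpos t ht1.le
      have h4 := hε (Set.mem_Ici.2 ht1.le) (Set.mem_Ici.2 h2) ht.2
      have h5 := ht.2
      gcongr
    refine le_trans (le_of_eq ?_) (mul_le_mul_right hle 2)
    rw [setLIntegral_const, Real.volume_Ioc, ← ENNReal.ofReal_mul (by positivity),
      ENNReal.ofReal_rpow_of_pos hE, ← ENNReal.ofReal_inv_of_pos (by positivity),
      ← ENNReal.ofReal_ofNat, ← ENNReal.ofReal_mul (by norm_num)]
    congr 1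
    field_simp
    ring
  calc ∑' k : ℕ, (ENNReal.ofReal (ε (2 ^ (k + 1))) ^ q)⁻¹
      ≤ ∑' k, 2 * ∫⁻ t in I k, ENNReal.ofReal (1 / (t * ε t ^ q)) := ENNReal.tsum_le_tsum hterm
    _ = 2 * ∫⁻ t in ⋃ k, I k, ENNReal.ofReal (1 / (t * ε t ^ q)) := by
        rw [lintegral_iUnion (fun _ => measurableSet_Ioc) hd, ENNReal.tsum_mul_left]
    _ ≤ 2 * 1 := by
        rw [← hint]
        gcongr 2 * ?_
        exact lintegral_mono_set hsub
    _ = 2 := mul_one 2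

variable {n : ℕ} {ι : Type*}

/-- Since ε(∞) = ∞ and all other factors of β are nonzero, an infinite ρ would make the bump
constant infinite. -/
theorem IsWeight.rho_ne_top {σ w : (Fin n → ℝ) → ℝ} (hσ : IsWeight σ) {α p q : ℝ} (hp : 0 < p)
    (hw : IsWeight w) {ε : ℝ → ℝ} (hB : bump α p q ε σ w ≠ ∞) {Q : Cube n}
    (h0 : wMeasure σ Q.toSet ≠ 0) (hw0 : wMeasure w Q.toSet ≠ 0) : rho σ Q ≠ ∞ := by
  intro h
  refine hB (top_le_iff.1 (le_trans (le_of_eq ?_) (le_iSup (beta α p q ε σ w) Q)))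
  have hm := hσ.wMeasure_ne_top Q
  have hv0 := Q.volume_ne_zero
  have hvt := Q.volume_ne_top
  rw [beta, h, epsAt, if_pos rfl, ENNReal.top_rpow_of_pos (by positivity), mul_assoc,
    ENNReal.top_mul_top, ENNReal.mul_top]
  rw [Ne, ENNReal.div_eq_zero_iff, not_or]
  refine ⟨mul_ne_zero ?_ ?_, ?_⟩
  · simp [h0, hm]
  · simp [hw0, hw.wMeasure_ne_top Q]
  · simp [hv0, hvt]

/-- The fractional average of `φ dσ` over the cube `Q`. -/
noncomputable def fracAvg (σ : (Fin n → ℝ) → ℝ) (e : ℝ) (φ : (Fin n → ℝ) → ℝ≥0∞) (Q : Cube n) : ℝ≥0∞ :=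
  (∫⁻ x in Q.toSet, φ x ∂(wMeasure σ)) / volume Q.toSet ^ e

/-- Split σ(Q) = σ(Q)^{1/p} σ(Q)^{1/p'}: the second factor completes β, the first belongs to the
Carleson term. -/
theorem IsWeight.fracAvg_mul_eq {σ w : (Fin n → ℝ) → ℝ} (hσ : IsWeight σ) {α p q : ℝ} (hp : 1 < p)
    {ε : ℝ → ℝ} {Q : Cube n} (h0 : wMeasure σ Q.toSet ≠ 0) (φ : (Fin n → ℝ) → ℝ≥0∞) :
    fracAvg σ (1 - α / n) φ Q * wMeasure w Q.toSet ^ (1 / q) * rho σ Q ^ (1 / p)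
        * epsAt ε (rho σ Q)
      = avg (wMeasure σ) φ Q.toSet * wMeasure σ Q.toSet ^ (1 / p) * beta α p q ε σ w Q := by
  have hm := hσ.wMeasure_ne_top Q
  have hsum : 1 / p + 1 / p.conjExponent = 1 := by
    simpa using (Real.HolderConjugate.conjExponent hp).inv_add_inv_eq_one
  have hsplit : ∫⁻ x in Q.toSet, φ x ∂(wMeasure σ) = avg (wMeasure σ) φ Q.toSet *
      (wMeasure σ Q.toSet ^ (1 / p) * wMeasure σ Q.toSet ^ (1 / p.conjExponent)) := by
    rw [← ENNReal.rpow_add _ _ h0 hm, hsum, ENNReal.rpow_one, avg_mul_measure h0 hm]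
  rw [fracAvg, hsplit, beta]
  simp only [div_eq_mul_inv (_ * _)]
  ring

/-- Raise the preceding identity to the power q. Since ρ ≥ 1 and q ≥ p, one power of ρ is available;
of (avg^p σ(Q))^{q/p}, Jensen turns all but one power into the norm of φ, and the remaining one is
kept for summation. -/
theorem fracAvg_rpow_mul_le {σ w : (Fin n → ℝ) → ℝ} (hσ : IsWeight σ) {α p q : ℝ}
    (hp : 1 < p) (hpq : p ≤ q) {ε : ℝ → ℝ} {φ : (Fin n → ℝ) → ℝ≥0∞}
    (hφ : AEMeasurable φ (wMeasure σ)) {Q : Cube n} (h0 : wMeasure σ Q.toSet ≠ 0) :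
    fracAvg σ (1 - α / n) φ Q ^ q * wMeasure w Q.toSet * rho σ Q * epsAt ε (rho σ Q) ^ q
      ≤ bump α p q ε σ w ^ q * (∫⁻ x, φ x ^ p ∂(wMeasure σ)) ^ (q / p - 1)
        * (avg (wMeasure σ) φ Q.toSet ^ p * wMeasure σ Q.toSet) := by
  have hp0 : 0 < p := by linarith
  have hq0 : 0 < q := by linarith
  have hm := hσ.wMeasure_ne_top Q
  have hqp : 0 ≤ q / p - 1 := by rw [sub_nonneg, le_div_iff₀ hp0]; linarith
  set l := fracAvg σ (1 - α / n) φ Q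
  set W := wMeasure w Q.toSet
  set r := rho σ Q
  set E := epsAt ε r
  set N := ∫⁻ x, φ x ^ p ∂(wMeasure σ)
  set b := avg (wMeasure σ) φ Q.toSet
  set m := wMeasure σ Q.toSet
  set B := bump α p q ε σ w
  have hr : r ≤ r ^ (1 / p * q) := by
    conv_lhs => rw [← ENNReal.rpow_one r]
    refine ENNReal.rpow_le_rpow_of_exponent_le (hσ.one_le_rho h0) ?_
    rw [one_div_mul_eq_div]; linarith
  have hN : b ^ p * m ≤ N := avg_rpow_mul_measure_le hφ hp h0 hm
  calc l ^ q * W * r * E ^ q ≤ l ^ q * W * r ^ (1 / p * q) * E ^ q := by gcongr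
    _ = (l * W ^ (1 / q) * r ^ (1 / p) * E) ^ q := by
        rw [ENNReal.mul_rpow_of_nonneg _ _ hq0.le, ENNReal.mul_rpow_of_nonneg _ _ hq0.le,
          ENNReal.mul_rpow_of_nonneg _ _ hq0.le, ← ENNReal.rpow_mul, ← ENNReal.rpow_mul,
          one_div_mul_cancel hq0.ne', ENNReal.rpow_one]
    _ = (b * m ^ (1 / p) * beta α p q ε σ w Q) ^ q := by
        rw [hσ.fracAvg_mul_eq hp h0]
    _ ≤ (b * m ^ (1 / p) * B) ^ q := by
        gcongr
        exact le_iSup (beta α p q ε σ w) Q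
    _ = B ^ q * (b ^ p * m) ^ (q / p) := by
        rw [ENNReal.mul_rpow_of_nonneg _ _ hq0.le, ENNReal.mul_rpow_of_nonneg _ _ hq0.le,
          ENNReal.mul_rpow_of_nonneg _ _ (by positivity), ← ENNReal.rpow_mul, ← ENNReal.rpow_mul,
          mul_div_cancel₀ _ hp0.ne', one_div_mul_eq_div]
        ring
    _ = B ^ q * ((b ^ p * m) ^ (q / p - 1) * (b ^ p * m)) := by
        congr 1
        conv_lhs => rw [show q / p = (q / p - 1) + 1 by ring]
        rw [ENNReal.rpow_add_of_nonneg _ _ hqp zero_le_one, ENNReal.rpow_one]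
    _ ≤ B ^ q * (N ^ (q / p - 1) * (b ^ p * m)) := by gcongr
    _ = _ := by ring

/-- Sorting by the size of ρ makes the Carleson constant of each level proportional to the power of
ρ gained from the bump, leaving only the series ∑ ε(2^k)^{-q}. -/
theorem sum_fracAvg_le_of_nondegenerate {α p q c : ℝ} (hp : 1 < p) (hpq : p ≤ q) (hc : 0 < c)
    {ε : ℝ → ℝ} (hε : MonotoneOn ε (Set.Ici 1)) (hcε : c ≤ ε 1)
    (hint : (∫⁻ t in Set.Ioi (1 : ℝ), ENNReal.ofReal (1 / (t * ε t ^ q))) = 1)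
    {σ w : (Fin n → ℝ) → ℝ} (hσ : IsWeight σ) (hw : IsWeight w) {φ : (Fin n → ℝ) → ℝ≥0∞}
    (hφ : AEMeasurable φ (wMeasure σ)) (hN : ∫⁻ x, φ x ^ p ∂(wMeasure σ) ≠ ∞)
    (hB : bump α p q ε σ w ≠ ∞) {Q : ι → Cube n}
    (hinj : Function.Injective fun i => (Q i).toSet) (hs : Laminar fun i => (Q i).toSet)
    (S : Finset ι) (hσ0 : ∀ i ∈ S, wMeasure σ (Q i).toSet ≠ 0)
    (hw0 : ∀ i ∈ S, wMeasure w (Q i).toSet ≠ 0)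
    (hpack : ∀ i ∈ S, ∀ G ⊆ S, (∀ j ∈ G, (Q j).toSet ⊆ (Q i).toSet) →
      ∑ j ∈ G, wMeasure σ (Q j).toSet ≤ 2 * (rho σ (Q i) * wMeasure σ (Q i).toSet)) :
    ∑ i ∈ S, fracAvg σ (1 - α / n) φ (Q i) ^ q * wMeasure w (Q i).toSet
      ≤ 2 ^ p * 4 * geomConst (p - 1) ^ p * ((ENNReal.ofReal c ^ q)⁻¹ + 2)
        * (bump α p q ε σ w ^ q * (∫⁻ x, φ x ^ p ∂(wMeasure σ)) ^ (q / p)) := by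
  classical
  have hp0 : 0 < p := by linarith
  have hq0 : 0 < q := by linarith
  have hqp : 0 ≤ q / p - 1 := by rw [sub_nonneg, le_div_iff₀ hp0]; linarith
  set N := ∫⁻ x, φ x ^ p ∂(wMeasure σ) with hNdef
  set B := bump α p q ε σ w
  have hrt : ∀ i ∈ S, rho σ (Q i) ≠ ∞ := fun i hi =>
    hσ.rho_ne_top hp0 hw hB (hσ0 i hi) (hw0 i hi)
  have hr1 : ∀ i ∈ S, 1 ≤ (rho σ (Q i)).toReal := fun i hi => by
    simpa using ENNReal.toReal_mono (hrt i hi) (hσ.one_le_rho (hσ0 i hi))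
  have hκ : ∀ i, ∃ k : ℕ, i ∈ S → (2 : ℝ) ^ k ≤ (rho σ (Q i)).toReal ∧
      (rho σ (Q i)).toReal < 2 ^ (k + 1) := fun i => by
    by_cases hi : i ∈ S
    · obtain ⟨k, hk⟩ := exists_nat_pow_near (hr1 i hi) one_lt_two
      exact ⟨k, fun _ => hk⟩
    · exact ⟨0, fun h => absurd h hi⟩
  choose κ hκ using hκ
  set e : ℕ → ℝ≥0∞ := fun k => ENNReal.ofReal (ε (2 ^ k)) ^ q with he
  have he0 : ∀ k, e k ≠ 0 ∧ e k ≠ ∞ := fun k => by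
    have h1 : (1 : ℝ) ≤ 2 ^ k := one_le_pow₀ one_le_two
    have : 0 < ε (2 ^ k) := hc.trans_le (hcε.trans (hε Set.self_mem_Ici h1 h1))
    refine ⟨?_, ENNReal.rpow_ne_top_of_nonneg hq0.le ENNReal.ofReal_ne_top⟩
    simp [he, hq0.not_gt, this]
  have hterm : ∀ i ∈ S, fracAvg σ (1 - α / n) φ (Q i) ^ q * wMeasure w (Q i).toSet
      ≤ B ^ q * N ^ (q / p - 1) * ((2 ^ κ i)⁻¹ * (e (κ i))⁻¹) *
        (avg (wMeasure σ) φ (Q i).toSet ^ p * wMeasure σ (Q i).toSet) := by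
    intro i hi
    obtain ⟨hk1, -⟩ := hκ i hi
    have h1 := fracAvg_rpow_mul_le (w := w) (α := α) (ε := ε) hσ hp hpq hφ (hσ0 i hi)
    have h2 : (2 : ℝ≥0∞) ^ κ i ≤ rho σ (Q i) := by
      have := ENNReal.ofReal_le_ofReal hk1
      rwa [ENNReal.ofReal_toReal (hrt i hi), ENNReal.ofReal_pow (by norm_num),
        ENNReal.ofReal_ofNat] at this
    have h3 : e (κ i) ≤ epsAt ε (rho σ (Q i)) ^ q := by
      rw [epsAt, if_neg (hrt i hi)]
      simp only [he]
      gcongr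
      exact hε (Set.mem_Ici.2 (one_le_pow₀ one_le_two)) (Set.mem_Ici.2 (hr1 i hi)) hk1
    have h4 : (2 : ℝ≥0∞) ^ κ i * (2 ^ κ i)⁻¹ = 1 :=
      ENNReal.mul_inv_cancel (by simp) (by simp)
    have h5 : e (κ i) * (e (κ i))⁻¹ = 1 := ENNReal.mul_inv_cancel (he0 _).1 (he0 _).2
    calc fracAvg σ (1 - α / n) φ (Q i) ^ q * wMeasure w (Q i).toSet
        = fracAvg σ (1 - α / n) φ (Q i) ^ q * wMeasure w (Q i).toSet *
          (2 ^ κ i * (2 ^ κ i)⁻¹) * (e (κ i) * (e (κ i))⁻¹) := by rw [h4, h5, mul_one, mul_one]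
      _ = (fracAvg σ (1 - α / n) φ (Q i) ^ q * wMeasure w (Q i).toSet * 2 ^ κ i * e (κ i)) *
          ((2 ^ κ i)⁻¹ * (e (κ i))⁻¹) := by ring
      _ ≤ (fracAvg σ (1 - α / n) φ (Q i) ^ q * wMeasure w (Q i).toSet * rho σ (Q i) *
          epsAt ε (rho σ (Q i)) ^ q) * ((2 ^ κ i)⁻¹ * (e (κ i))⁻¹) := by gcongr
      _ ≤ _ := mul_le_mul_left h1 _
      _ = _ := by ring
  -- Packing gives the constant 2ρ, and ρ < 2^{k+1} on level k turns it into 4·2^k.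
  have hcarl : ∀ k, ∑ i ∈ S with κ i = k,
      avg (wMeasure σ) φ (Q i).toSet ^ p * wMeasure σ (Q i).toSet
        ≤ 2 ^ p * (4 * 2 ^ k) * geomConst (p - 1) ^ p * N := by
    intro k
    refine carleson_embedding (s := fun i => (Q i).toSet) hs hinj (fun i => (Q i).measurableSet)
      hφ hp hN _ (fun i hi => hσ0 i (Finset.mem_filter.1 hi).1)
      (fun i _ => hσ.wMeasure_ne_top (Q i)) fun i hi G hG hGi => ?_
    obtain ⟨hiS, rfl⟩ := Finset.mem_filter.1 hi
    refine (hpack i hiS G (hG.trans (Finset.filter_subset _ _)) hGi).trans ?_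
    have h2 : rho σ (Q i) ≤ 2 ^ (κ i + 1) := by
      have := ENNReal.ofReal_le_ofReal (hκ i hiS).2.le
      rwa [ENNReal.ofReal_toReal (hrt i hiS), ENNReal.ofReal_pow (by norm_num),
        ENNReal.ofReal_ofNat] at this
    calc 2 * (rho σ (Q i) * wMeasure σ (Q i).toSet)
        ≤ 2 * (2 ^ (κ i + 1) * wMeasure σ (Q i).toSet) := by gcongr
      _ = _ := by ring
  set D := B ^ q * N ^ (q / p - 1) with hD
  calc ∑ i ∈ S, fracAvg σ (1 - α / n) φ (Q i) ^ q * wMeasure w (Q i).toSet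
      ≤ ∑ i ∈ S, D * ((2 ^ κ i)⁻¹ * (e (κ i))⁻¹) *
        (avg (wMeasure σ) φ (Q i).toSet ^ p * wMeasure σ (Q i).toSet) := Finset.sum_le_sum hterm
    _ = ∑ k ∈ S.image κ, ∑ i ∈ S with κ i = k, D * ((2 ^ κ i)⁻¹ * (e (κ i))⁻¹) *
        (avg (wMeasure σ) φ (Q i).toSet ^ p * wMeasure σ (Q i).toSet) :=
        (Finset.sum_fiberwise_of_maps_to (fun i hi => Finset.mem_image_of_mem κ hi) _).symm
    _ ≤ ∑ k ∈ S.image κ, 2 ^ p * 4 * geomConst (p - 1) ^ p * D * N * (e k)⁻¹ := by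
        refine Finset.sum_le_sum fun k _ => ?_
        calc ∑ i ∈ S with κ i = k, D * ((2 ^ κ i)⁻¹ * (e (κ i))⁻¹) *
              (avg (wMeasure σ) φ (Q i).toSet ^ p * wMeasure σ (Q i).toSet)
            = D * ((2 ^ k)⁻¹ * (e k)⁻¹) * ∑ i ∈ S with κ i = k,
              (avg (wMeasure σ) φ (Q i).toSet ^ p * wMeasure σ (Q i).toSet) := by
              rw [Finset.mul_sum]
              refine Finset.sum_congr rfl fun i hi => ?_
              rw [(Finset.mem_filter.1 hi).2]
          _ ≤ D * ((2 ^ k)⁻¹ * (e k)⁻¹) * (2 ^ p * (4 * 2 ^ k) * geomConst (p - 1) ^ p * N) := by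
              gcongr; exact hcarl k
          _ = 2 ^ p * 4 * geomConst (p - 1) ^ p * D * N * (e k)⁻¹ * (2 ^ k * (2 ^ k)⁻¹) := by ring
          _ = _ := by rw [ENNReal.mul_inv_cancel (by simp) (by simp), mul_one]
    _ = 2 ^ p * 4 * geomConst (p - 1) ^ p * D * N * ∑ k ∈ S.image κ, (e k)⁻¹ :=
        (Finset.mul_sum _ _ _).symm
    _ ≤ 2 ^ p * 4 * geomConst (p - 1) ^ p * D * N * ((ENNReal.ofReal c ^ q)⁻¹ + 2) := by
        gcongr
        exact (ENNReal.sum_le_tsum _).trans (tsum_inv_eps_le hε hc hcε hq0 hint)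
    _ = _ := by
        have : N ^ (q / p) = N ^ (q / p - 1) * N := by
          conv_lhs => rw [show q / p = (q / p - 1) + 1 by ring]
          rw [ENNReal.rpow_add_of_nonneg _ _ hqp zero_le_one, ENNReal.rpow_one]
        rw [this, hD]
        ring

end

/-! ### Shifted dyadic grids and the one-third trick -/

section

variable {n : ℕ}

/-- The relative shift of the dyadic grid at scale `2 ^ k`. -/
noncomputable def gridShift (t : Bool) (k : ℤ) : ℝ := if t then (-1) ^ k / 3 else 0

/-- The cubes of `2 ^ n` shifted dyadic grids. -/
noncomputable def dyadicCube (t : Fin n → Bool) (i : ℤ × (Fin n → ℤ)) : Cube n where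
  corner j := 2 ^ i.1 * (i.2 j + gridShift (t j) i.1)
  side := 2 ^ i.1
  side_pos := by positivity

theorem neg_one_zpow_eq_or (k : ℤ) : (-1 : ℝ) ^ k = 1 ∨ (-1 : ℝ) ^ k = -1 :=
  (Int.even_or_odd k).imp Even.neg_one_zpow Odd.neg_one_zpow

theorem gridShift_succ (t : Bool) (k : ℤ) : gridShift t (k + 1) = -gridShift t k := by
  cases t <;> simp [gridShift, zpow_add₀, neg_div]

theorem exists_int_three_mul_gridShift (t : Bool) (k : ℤ) : ∃ z : ℤ, 3 * gridShift t k = z := by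
  cases t
  · exact ⟨0, by simp [gridShift]⟩
  · rcases neg_one_zpow_eq_or k with h | h
    · exact ⟨1, by simp [gridShift, h]⟩
    · exact ⟨-1, by simp [gridShift, h]; norm_num⟩

/-- The alternating sign is chosen for this: 2s_{k+1} = -2s_k = s_k - 3s_k with 3s_k an integer, so
endpoints of a coarse grid are endpoints of every finer one. -/
theorem exists_int_two_pow_mul_gridShift (t : Bool) (k : ℤ) (d : ℕ) :
    ∃ z : ℤ, 2 ^ d * gridShift t (k + d) = z + gridShift t k := by
  induction d with
  | zero => exact ⟨0, by simp⟩
  | succ d ih =>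
    obtain ⟨z, hz⟩ := ih
    obtain ⟨y, hy⟩ := exists_int_three_mul_gridShift t k
    refine ⟨-2 * z - y, ?_⟩
    push_cast
    rw [← add_assoc, gridShift_succ, pow_succ, ← hy]
    linear_combination (-2) * hz

/-- Intersecting intervals of one shifted dyadic grid are nested. -/
theorem grid_nested (t : Bool) {j k : ℤ} (hjk : j ≤ k) (a b : ℤ) {x : ℝ}
    (hj : x ∈ Set.Ico (2 ^ j * (a + gridShift t j)) (2 ^ j * (a + gridShift t j) + 2 ^ j))
    (hk : x ∈ Set.Ico (2 ^ k * (b + gridShift t k)) (2 ^ k * (b + gridShift t k) + 2 ^ k)) :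
    2 ^ k * (b + gridShift t k) ≤ 2 ^ j * (a + gridShift t j) ∧
      2 ^ j * (a + gridShift t j) + 2 ^ j ≤ 2 ^ k * (b + gridShift t k) + (2 : ℝ) ^ k := by
  obtain ⟨d, rfl⟩ := Int.le.dest hjk
  obtain ⟨z, hz⟩ := exists_int_two_pow_mul_gridShift t j d
  have h2 : (0 : ℝ) < 2 ^ j := by positivity
  have hpow : (2 : ℝ) ^ (j + (d : ℤ)) = 2 ^ j * 2 ^ d := by
    rw [zpow_add₀ two_ne_zero, zpow_natCast]
  have hkc : (2 : ℝ) ^ (j + (d : ℤ)) * (b + gridShift t (j + d))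
      = 2 ^ j * (((2 ^ d * b + z : ℤ) : ℝ) + gridShift t j) := by
    rw [hpow]
    push_cast
    linear_combination 2 ^ j * hz
  rw [hkc, hpow] at hk ⊢
  have h1 : 2 ^ j * (((2 ^ d * b + z : ℤ) : ℝ) + gridShift t j)
      < 2 ^ j * (a + 1 + gridShift t j) := by
    linarith [hk.1, hj.2]
  have h3 : 2 ^ j * (a + gridShift t j)
      < 2 ^ j * ((2 ^ d * b + z : ℤ) + 2 ^ d + gridShift t j) := by
    linarith [hj.1, hk.2]
  have h1' := lt_of_mul_lt_mul_left h1 h2.le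
  have h3' := lt_of_mul_lt_mul_left h3 h2.le
  -- In units of the finer scale all endpoints differ by integers, so strict overlap improves to
  -- containment.
  have h4 : 2 ^ d * b + z ≤ a := by
    rw [← Int.lt_add_one_iff]
    have : ((2 ^ d * b + z : ℤ) : ℝ) < a + 1 := by linarith
    exact_mod_cast this
  have h5 : a + 1 ≤ 2 ^ d * b + z + 2 ^ d := by
    have : (a : ℝ) < (2 ^ d * b + z : ℤ) + 2 ^ d := by linarith
    have : a < 2 ^ d * b + z + 2 ^ d := by exact_mod_cast this
    linarith
  have h4' : ((2 ^ d * b + z : ℤ) : ℝ) ≤ a := by exact_mod_cast h4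
  have h5' : (a : ℝ) + 1 ≤ (2 ^ d * b + z : ℤ) + 2 ^ d := by exact_mod_cast h5
  have h6 := mul_le_mul_of_nonneg_left h4' h2.le
  have h7 := mul_le_mul_of_nonneg_left h5' h2.le
  constructor <;> linarith

theorem Cube.mem_toSet {Q : Cube n} {x : Fin n → ℝ} :
    x ∈ Q.toSet ↔ ∀ j, Q.corner j ≤ x j ∧ x j < Q.corner j + Q.side := by
  simp [Cube.toSet]

theorem Cube.subset_of_forall {P Q : Cube n} (h : ∀ j, Q.corner j ≤ P.corner j ∧
    P.corner j + P.side ≤ Q.corner j + Q.side) : P.toSet ⊆ Q.toSet := by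
  intro x hx
  rw [Cube.mem_toSet] at hx ⊢
  exact fun j => ⟨(h j).1.trans (hx j).1, (hx j).2.trans_le (h j).2⟩

theorem dyadicCube_subset_of_le (t : Fin n → Bool) {i j : ℤ × (Fin n → ℤ)} (hij : i.1 ≤ j.1)
    (h : ¬ Disjoint (dyadicCube t i).toSet (dyadicCube t j).toSet) :
    (dyadicCube t i).toSet ⊆ (dyadicCube t j).toSet := by
  obtain ⟨x, hxi, hxj⟩ := Set.not_disjoint_iff.1 h
  rw [Cube.mem_toSet] at hxi hxj
  exact Cube.subset_of_forall fun l => grid_nested (t l) hij (i.2 l) (j.2 l) (hxi l) (hxj l)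

theorem laminar_dyadicCube (t : Fin n → Bool) : Laminar fun i => (dyadicCube t i).toSet := by
  intro i j
  by_cases h : Disjoint (dyadicCube t i).toSet (dyadicCube t j).toSet
  · exact Or.inr (Or.inr h)
  rcases le_total i.1 j.1 with hij | hij
  · exact Or.inl (dyadicCube_subset_of_le t hij h)
  · exact Or.inr (Or.inl (dyadicCube_subset_of_le t hij fun h' => h h'.symm))

theorem Cube.corner_mem (Q : Cube n) : Q.corner ∈ Q.toSet :=
  Cube.mem_toSet.2 fun _ => ⟨le_rfl, lt_add_of_pos_right _ Q.side_pos⟩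

theorem Cube.corner_eq_of_toSet_eq {P Q : Cube n} (h : P.toSet = Q.toSet) :
    P.corner = Q.corner := by
  funext j
  exact le_antisymm (Cube.mem_toSet.1 (h ▸ Q.corner_mem) j).1
    (Cube.mem_toSet.1 (h ▸ P.corner_mem) j).1

theorem Cube.side_eq_of_toSet_eq (hn : n ≠ 0) {P Q : Cube n} (h : P.toSet = Q.toSet) :
    P.side = Q.side := by
  have hv : ENNReal.ofReal P.side ^ n = ENNReal.ofReal Q.side ^ n := by
    rw [← P.volume_eq, ← Q.volume_eq, h]
  rw [← ENNReal.ofReal_pow P.side_pos.le, ← ENNReal.ofReal_pow Q.side_pos.le,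
    ENNReal.ofReal_eq_ofReal_iff (pow_nonneg P.side_pos.le _) (pow_nonneg Q.side_pos.le _)] at hv
  exact (pow_left_inj₀ P.side_pos.le Q.side_pos.le hn).1 hv

/-- The side is recovered from the volume, which fails in dimension zero, where all cubes coincide
as sets. -/
theorem injective_dyadicCube (hn : n ≠ 0) (t : Fin n → Bool) :
    Function.Injective fun i => (dyadicCube t i).toSet := by
  rintro ⟨k, a⟩ ⟨l, b⟩ h
  have hs := Cube.side_eq_of_toSet_eq hn h
  have hkl : k = l := zpow_right_injective₀ two_pos (by norm_num) hs
  subst hkl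
  congr 1
  funext j
  have hc := congrFun (Cube.corner_eq_of_toSet_eq h) j
  simpa [dyadicCube, zpow_ne_zero] using hc

/-- The one-third trick in one dimension. -/
theorem exists_grid_interval (k : ℤ) (a l : ℝ) (h : 3 * l ≤ 2 ^ k) :
    ∃ (t : Bool) (m : ℤ), 2 ^ k * (m + gridShift t k) ≤ a ∧
      a + l ≤ 2 ^ k * (m + gridShift t k) + 2 ^ k := by
  have h2 : (0 : ℝ) < 2 ^ k := by positivity
  set u := a / 2 ^ k with hu
  have ha : a = 2 ^ k * u := by rw [hu]; field_simp
  have hf1 := Int.floor_le u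
  have hf2 := Int.lt_floor_add_one u
  have red : ∀ y : ℝ, y ≤ u → u + 1 / 3 ≤ y + 1 → 2 ^ k * y ≤ a ∧ a + l ≤ 2 ^ k * y + 2 ^ k := by
    intro y h3 h4
    have h5 := mul_le_mul_of_nonneg_left h3 h2.le
    have h6 := mul_le_mul_of_nonneg_left h4 h2.le
    constructor <;> linarith
  by_cases hc : u + 1 / 3 ≤ ⌊u⌋ + 1
  · exact ⟨false, ⌊u⌋, red _ (by simpa [gridShift] using hf1) (by simpa [gridShift] using hc)⟩
  -- Now `u` is in the last third of its unit interval; the shifted interval starting at ⌊u⌋ + 1/3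
  -- or ⌊u⌋ + 2/3, depending on the sign, reaches past u + 1/3.
  · rcases neg_one_zpow_eq_or k with hs | hs
    · refine ⟨true, ⌊u⌋, red _ ?_ ?_⟩ <;> simp only [gridShift, if_true, hs] <;> linarith
    · refine ⟨true, ⌊u⌋ + 1, red _ ?_ ?_⟩ <;> simp only [gridShift, if_true, hs] <;>
        push_cast <;> linarith

/-- Every cube lies in a cube of comparable size from one of the shifted dyadic grids. -/
theorem Cube.exists_subset_dyadicCube (Q : Cube n) :
    ∃ (t : Fin n → Bool) (i : ℤ × (Fin n → ℤ)), Q.toSet ⊆ (dyadicCube t i).toSet ∧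
      volume (dyadicCube t i).toSet ≤ 6 ^ n * volume Q.toSet := by
  obtain ⟨k, hk1, hk2⟩ := exists_mem_Ioc_zpow (show (0 : ℝ) < 3 * Q.side by
    linarith [Q.side_pos]) one_lt_two
  -- The grid is chosen in each coordinate separately, hence 2^n grids; 2^k < 3 · side makes the new
  -- side less than 6 · side.
  choose t m h1 h2 using fun j => exists_grid_interval (k + 1) (Q.corner j) Q.side hk2
  refine ⟨t, (k + 1, m), Cube.subset_of_forall fun j => ⟨h1 j, h2 j⟩, ?_⟩
  rw [Cube.volume_eq, Cube.volume_eq, ← mul_pow]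
  gcongr
  rw [← ENNReal.ofReal_ofNat, ← ENNReal.ofReal_mul (by norm_num)]
  refine ENNReal.ofReal_le_ofReal ?_
  simp only [dyadicCube]
  rw [zpow_add_one₀ two_ne_zero]
  linarith

end

/-! ### From sparse families to the maximal function -/

section

variable {n : ℕ}

/-- The constant in the weighted estimate for sparse families. -/
noncomputable def sparseConst (p q c : ℝ) : ℝ≥0∞ :=
  2 ^ p * 4 * geomConst (p - 1) ^ p * ((ENNReal.ofReal c ^ q)⁻¹ + 2)

theorem sparseConst_ne_zero {p q c : ℝ} (hp : 1 < p) : sparseConst p q c ≠ 0 := by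
  have hp0 : 0 < p := by linarith
  have hg : geomConst (p - 1) ≠ 0 := by
    rw [geomConst, ENNReal.inv_ne_zero]
    exact ENNReal.sub_ne_top ENNReal.one_ne_top
  simp [sparseConst, hp0.not_gt, hg]

theorem sparseConst_ne_top {p q c : ℝ} (hp : 1 < p) (hq : 0 < q) (hc : 0 < c) :
    sparseConst p q c ≠ ∞ := by
  have hp0 : 0 < p := by linarith
  refine ENNReal.mul_ne_top (ENNReal.mul_ne_top (ENNReal.mul_ne_top ?_ (by simp)) ?_) ?_
  · exact ENNReal.rpow_ne_top_of_nonneg hp0.le (by simp)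
  · exact ENNReal.rpow_ne_top_of_nonneg hp0.le (geomConst_ne_top (by linarith))
  · refine ENNReal.add_ne_top.2 ⟨?_, by simp⟩
    simp [hq.not_gt, hc]

/-- The weighted estimate for sums over principal cubes. -/
theorem sum_fracAvg_le {α p q c : ℝ} (hα : 0 ≤ α) (hαn : α < n)
    (hp : 1 < p) (hpq : p ≤ q) (hc : 0 < c)
    {ε : ℝ → ℝ} (hε : MonotoneOn ε (Set.Ici 1)) (hcε : c ≤ ε 1)
    (hint : (∫⁻ t in Set.Ioi (1 : ℝ), ENNReal.ofReal (1 / (t * ε t ^ q))) = 1)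
    {σ w : (Fin n → ℝ) → ℝ} (hσ : IsWeight σ) (hw : IsWeight w) {φ : (Fin n → ℝ) → ℝ≥0∞}
    (hφ : AEMeasurable φ (wMeasure σ)) {ι : Type*} {Q : ι → Cube n}
    (hinj : Function.Injective fun i => (Q i).toSet) (hs : Laminar fun i => (Q i).toSet)
    (S : Finset ι)
    (hsep : ∀ i ∈ S, ∀ j ∈ S, i ≠ j → (Q i).toSet ⊆ (Q j).toSet →
      2 * fracAvg σ (1 - α / n) φ (Q j) < fracAvg σ (1 - α / n) φ (Q i)) :
    ∑ i ∈ S, fracAvg σ (1 - α / n) φ (Q i) ^ q * wMeasure w (Q i).toSet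
      ≤ sparseConst p q c
        * (bump α p q ε σ w ^ q * (∫⁻ x, φ x ^ p ∂(wMeasure σ)) ^ (q / p)) := by
  classical
  have hp0 : 0 < p := by linarith
  have hq0 : 0 < q := by linarith
  have hn0 : (0 : ℝ) < n := hα.trans_lt hαn
  set N := ∫⁻ x, φ x ^ p ∂(wMeasure σ) with hNdef
  set B := bump α p q ε σ w with hBdef
  have hfrac0 : ∀ i, wMeasure σ (Q i).toSet = 0 → fracAvg σ (1 - α / n) φ (Q i) = 0 := by
    intro i hi
    rw [fracAvg, setLIntegral_measure_zero _ _ hi, ENNReal.zero_div]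
  -- The right side may be 0 · ∞ = 0, so every term must vanish; this follows from the single-cube
  -- bound because ρ and ε(ρ) are nonzero.
  by_cases hz : B = 0 ∨ N = 0
  · refine le_of_eq_of_le (Finset.sum_eq_zero fun i _ => ?_) zero_le
    by_cases h0 : wMeasure σ (Q i).toSet = 0
    · rw [hfrac0 i h0, ENNReal.zero_rpow_of_pos hq0, zero_mul]
    have hr := hσ.one_le_rho h0
    have hE : epsAt ε (rho σ (Q i)) ≠ 0 := by
      rw [epsAt]
      split_ifs with h
      · simp
      · have h1 : (1 : ℝ) ≤ (rho σ (Q i)).toReal := by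
          simpa using ENNReal.toReal_mono h hr
        simpa using hc.trans_le (hcε.trans (hε Set.self_mem_Ici h1 h1))
    have h1 := fracAvg_rpow_mul_le (w := w) (α := α) (ε := ε) hσ hp hpq hφ h0
    have h2 : B ^ q * N ^ (q / p - 1) *
        (avg (wMeasure σ) φ (Q i).toSet ^ p * wMeasure σ (Q i).toSet) = 0 := by
      rcases hz with hz | hz
      · rw [hz, ENNReal.zero_rpow_of_pos hq0, zero_mul, zero_mul]
      · have := avg_rpow_mul_measure_le hφ hp h0 (hσ.wMeasure_ne_top (Q i))
        rw [← hNdef, hz] at this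
        rw [le_antisymm this zero_le, mul_zero]
    have h3 := le_antisymm (h1.trans_eq h2) zero_le
    have h4 : epsAt ε (rho σ (Q i)) ^ q ≠ 0 := by simp [hE, hq0.not_gt]
    have h5 : rho σ (Q i) ≠ 0 := (zero_lt_one.trans_le hr).ne'
    exact (mul_eq_zero.1 ((mul_eq_zero.1 h3).resolve_right h4)).resolve_right h5
  obtain ⟨hB0, hN0⟩ := not_or.1 hz
  by_cases hBt : B = ∞
  · have : N ^ (q / p) ≠ 0 := by simp [hN0, (div_pos hq0 hp0).not_gt]
    rw [hBt, ENNReal.top_rpow_of_pos hq0, ENNReal.top_mul this,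
      ENNReal.mul_top (sparseConst_ne_zero hp)]
    exact le_top
  by_cases hNt : N = ∞
  · have : B ^ q ≠ 0 := by simp [hB0, hq0.not_gt]
    rw [hNt, ENNReal.top_rpow_of_pos (div_pos hq0 hp0), ENNReal.mul_top this,
      ENNReal.mul_top (sparseConst_ne_zero hp)]
    exact le_top
  set S' := S.filter fun i => wMeasure σ (Q i).toSet ≠ 0 ∧ wMeasure w (Q i).toSet ≠ 0 with hS'
  have hS'S : S' ⊆ S := Finset.filter_subset _ _
  have hsum : ∑ i ∈ S', fracAvg σ (1 - α / n) φ (Q i) ^ q * wMeasure w (Q i).toSet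
      = ∑ i ∈ S, fracAvg σ (1 - α / n) φ (Q i) ^ q * wMeasure w (Q i).toSet := by
    refine Finset.sum_filter_of_ne fun i _ hne => ⟨fun h => hne ?_, right_ne_zero_of_mul hne⟩
    rw [hfrac0 i h, ENNReal.zero_rpow_of_pos hq0, zero_mul]
  rw [← hsum]
  refine sum_fracAvg_le_of_nondegenerate hp hpq hc hε hcε hint hσ hw hφ hNt hBt hinj hs S'
    (fun i hi => (Finset.mem_filter.1 hi).2.1) (fun i hi => (Finset.mem_filter.1 hi).2.2) ?_
  intro i hi G hG hGi
  rw [hσ.rho_mul (Finset.mem_filter.1 hi).2.1]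
  -- Sparseness is taken from the full family `S`; packing then holds for any subfamily.
  refine hσ.sum_measure_le hs (S := S) (fun j hj => ?_) (Q i) (hG.trans hS'S) hGi
  refine measure_le_two_mul_ownPart (s := fun i => (Q i).toSet) (μ := wMeasure σ) (φ := φ)
    (e := 1 - α / n) hs
    (fun i => (Q i).measurableSet) ?_ ?_ S (fun i => (Q i).volume_ne_zero)
    (fun i => (Q i).volume_ne_top) hsep hj
  · rw [sub_pos, div_lt_one hn0]; exact hαn
  · linarith [div_nonneg hα hn0.le]

/-- The weighted estimate for the maximal function of one dyadic grid. -/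
theorem lintegral_iSup_fracAvg_le {α p q c : ℝ} (hα : 0 ≤ α) (hαn : α < n)
    (hp : 1 < p) (hpq : p ≤ q) (hc : 0 < c)
    {ε : ℝ → ℝ} (hε : MonotoneOn ε (Set.Ici 1)) (hcε : c ≤ ε 1)
    (hint : (∫⁻ t in Set.Ioi (1 : ℝ), ENNReal.ofReal (1 / (t * ε t ^ q))) = 1)
    {σ w : (Fin n → ℝ) → ℝ} (hσ : IsWeight σ) (hw : IsWeight w) {φ : (Fin n → ℝ) → ℝ≥0∞}
    (hφ : AEMeasurable φ (wMeasure σ)) {ι : Type*} [Countable ι] {Q : ι → Cube n}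
    (hinj : Function.Injective fun i => (Q i).toSet) (hs : Laminar fun i => (Q i).toSet) :
    ∫⁻ x, ⨆ i, (Q i).toSet.indicator (fun _ => fracAvg σ (1 - α / n) φ (Q i) ^ q) x ∂(wMeasure w)
      ≤ 2 ^ q * sparseConst p q c
        * (bump α p q ε σ w ^ q * (∫⁻ x, φ x ^ p ∂(wMeasure σ)) ^ (q / p)) := by
  have hq0 : 0 < q := by linarith
  set l : ι → ℝ≥0∞ := fun i => fracAvg σ (1 - α / n) φ (Q i) with hl
  have hmeas : ∀ i, Measurable ((Q i).toSet.indicator fun _ => l i ^ q) := fun i =>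
    measurable_const.indicator (Q i).measurableSet
  -- Monotone convergence over finite subfamilies, since principal cubes are selected only from
  -- finite families.
  set g : Finset ι → (Fin n → ℝ) → ℝ≥0∞ := fun F x =>
    ⨆ i ∈ F, (Q i).toSet.indicator (fun _ => l i ^ q) x with hg
  have hgm : ∀ F, Measurable (g F) := fun F =>
    Measurable.biSup _ F.countable_toSet fun i _ => hmeas i
  have hgmono : Monotone g := fun F G hFG x =>
    biSup_mono fun i hi => hFG hi
  have hsup : ∀ x, ⨆ i, (Q i).toSet.indicator (fun _ => l i ^ q) x = ⨆ F, g F x := fun x =>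
    iSup_eq_iSup_finset _
  rw [lintegral_congr hsup, lintegral_iSup_directed (fun F => (hgm F).aemeasurable)
    hgmono.directed_le]
  refine iSup_le fun F => ?_
  obtain ⟨S, -, hcov, hsep⟩ := exists_principal hinj l F
  have hpt : ∀ x, g F x ≤ 2 ^ q * ∑ i ∈ S, (Q i).toSet.indicator (fun _ => l i ^ q) x := by
    intro x
    refine iSup₂_le fun i hi => ?_
    by_cases hx : x ∈ (Q i).toSet
    · obtain ⟨j, hj, hsub, hlj⟩ := hcov i hi
      rw [Set.indicator_of_mem hx]
      calc l i ^ q ≤ (2 * l j) ^ q := by gcongr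
        _ = 2 ^ q * (Q j).toSet.indicator (fun _ => l j ^ q) x := by
            rw [ENNReal.mul_rpow_of_nonneg _ _ hq0.le, Set.indicator_of_mem (hsub hx)]
        _ ≤ _ := by
            gcongr
            exact Finset.single_le_sum
              (f := fun i => (Q i).toSet.indicator (fun _ => l i ^ q) x) (fun _ _ => zero_le) hj
    · rw [Set.indicator_of_notMem hx]
      exact zero_le
  calc ∫⁻ x, g F x ∂(wMeasure w)
      ≤ ∫⁻ x, 2 ^ q * ∑ i ∈ S, (Q i).toSet.indicator (fun _ => l i ^ q) x ∂(wMeasure w) :=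
        lintegral_mono hpt
    _ = 2 ^ q * ∑ i ∈ S, l i ^ q * wMeasure w (Q i).toSet := by
        rw [lintegral_const_mul _ (Finset.measurable_fun_sum _ fun i _ => hmeas i),
          lintegral_finsetSum _ fun i _ => hmeas i]
        simp_rw [lintegral_indicator_const (Q _).measurableSet]
    _ ≤ 2 ^ q * (sparseConst p q c
          * (bump α p q ε σ w ^ q * (∫⁻ x, φ x ^ p ∂(wMeasure σ)) ^ (q / p))) := by
        gcongr
        exact sum_fracAvg_le hα hαn hp hpq hc hε hcε hint hσ hw hφ hinj hs S hsep
    _ = _ := by ring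

/-- The fractional maximal function is controlled by its dyadic analogues. -/
theorem fracMaximal_rpow_le {α q : ℝ} (hα : 0 ≤ α) (hαn : α < n) (hq : 0 < q)
    {σ : (Fin n → ℝ) → ℝ} (hσ : IsWeight σ) {f : (Fin n → ℝ) → ℝ}
    (hf : AEStronglyMeasurable f (wMeasure σ)) (x : Fin n → ℝ) :
    fracMaximal α (fun x => f x * σ x) x ^ q ≤ (6 ^ n) ^ q * ∑ t : Fin n → Bool,
      ⨆ i, (dyadicCube t i).toSet.indicator
        (fun _ => fracAvg σ (1 - α / n) (fun y => ‖f y‖ₑ) (dyadicCube t i) ^ q) x := by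
  have hn0 : (0 : ℝ) < n := hα.trans_lt hαn
  have he0 : 0 < 1 - α / n := by rw [sub_pos, div_lt_one hn0]; exact hαn
  have he1 : 1 - α / n ≤ 1 := by linarith [div_nonneg hα hn0.le]
  set e := 1 - α / n
  set φ : (Fin n → ℝ) → ℝ≥0∞ := fun y => ‖f y‖ₑ with hφ
  set H : (Fin n → Bool) → ℝ≥0∞ := fun t => ⨆ i, (dyadicCube t i).toSet.indicator
    (fun _ => fracAvg σ e φ (dyadicCube t i) ^ q) x with hH
  suffices h : fracMaximal α (fun x => f x * σ x) x ≤ 6 ^ n * (∑ t, H t) ^ (1 / q) by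
    refine (ENNReal.rpow_le_rpow h hq.le).trans_eq ?_
    rw [ENNReal.mul_rpow_of_nonneg _ _ hq.le, ← ENNReal.rpow_mul, one_div_mul_cancel hq.ne',
      ENNReal.rpow_one]
  refine iSup₂_le fun Q hx => ?_
  -- `f` is measurable only up to null sets of σ dx, so the almost-everywhere form of the density
  -- formula is required.
  have hI : ∫⁻ y in Q.toSet, ‖f y * σ y‖ₑ = ∫⁻ y in Q.toSet, φ y ∂(wMeasure σ) := by
    rw [wMeasure, restrict_withDensity Q.measurableSet, lintegral_withDensity_eq_lintegral_mul₀'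
      hσ.aemeasurable.restrict]
    · refine lintegral_congr fun y => ?_
      rw [Pi.mul_apply, enorm_mul, hσ.enorm_eq, mul_comm]
    · rw [← restrict_withDensity Q.measurableSet]
      exact hf.enorm.restrict
  obtain ⟨t, i, hsub, hvol⟩ := Q.exists_subset_dyadicCube
  set D := dyadicCube t i with hD
  have hve : volume D.toSet ^ e ≤ 6 ^ n * volume Q.toSet ^ e := by
    calc volume D.toSet ^ e ≤ (6 ^ n * volume Q.toSet) ^ e := by gcongr
      _ = (6 ^ n) ^ e * volume Q.toSet ^ e := ENNReal.mul_rpow_of_nonneg _ _ he0.le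
      _ ≤ (6 ^ n) ^ (1 : ℝ) * volume Q.toSet ^ e := by
          gcongr ?_ * _
          exact ENNReal.rpow_le_rpow_of_exponent_le (one_le_pow₀ (by norm_num)) he1
      _ = _ := by rw [ENNReal.rpow_one]
  have hDe0 : volume D.toSet ^ e ≠ 0 := by simp [D.volume_ne_zero, D.volume_ne_top]
  have hDet : volume D.toSet ^ e ≠ ∞ := ENNReal.rpow_ne_top_of_nonneg he0.le D.volume_ne_top
  have h1 : fracAvg σ e φ Q ≤ 6 ^ n * fracAvg σ e φ D := by
    refine ENNReal.div_le_of_le_mul ?_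
    calc ∫⁻ y in Q.toSet, φ y ∂(wMeasure σ) ≤ ∫⁻ y in D.toSet, φ y ∂(wMeasure σ) :=
          lintegral_mono_set hsub
      _ = fracAvg σ e φ D * volume D.toSet ^ e := (ENNReal.div_mul_cancel hDe0 hDet).symm
      _ ≤ fracAvg σ e φ D * (6 ^ n * volume Q.toSet ^ e) := by gcongr
      _ = _ := by ring
  have h2 : fracAvg σ e φ D ^ q ≤ H t := by
    refine le_trans (le_of_eq ?_) (le_iSup _ i)
    rw [Set.indicator_of_mem (hsub hx)]
  have h3 : H t ≤ ∑ t, H t := Finset.single_le_sum (fun _ _ => zero_le) (Finset.mem_univ t)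
  calc (∫⁻ y in Q.toSet, ‖f y * σ y‖ₑ) / volume Q.toSet ^ e = fracAvg σ e φ Q := by
        rw [hI, fracAvg]
    _ ≤ 6 ^ n * fracAvg σ e φ D := h1
    _ = 6 ^ n * (fracAvg σ e φ D ^ q) ^ (1 / q) := by
        rw [← ENNReal.rpow_mul, mul_one_div_cancel hq.ne', ENNReal.rpow_one]
    _ ≤ _ := by
        gcongr
        exact h2.trans h3

end

end EntropyBump

theorem theorem1p2 (n : ℕ) (α p q c : ℝ) (hα : 0 < α) (hαn : α < n)
    (hp : 1 < p) (hpq : p ≤ q) (hc : 0 < c) :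
    ∃ C : ℝ≥0, ∀ ε : ℝ → ℝ, MonotoneOn ε (Set.Ici 1) → c ≤ ε 1 →
      (∫⁻ t in Set.Ioi (1 : ℝ), ENNReal.ofReal (1 / (t * ε t ^ q))) = 1 →
      ∀ σ w : (Fin n → ℝ) → ℝ, EntropyBump.IsWeight σ → EntropyBump.IsWeight w →
      ∀ f : (Fin n → ℝ) → ℝ, AEStronglyMeasurable f (EntropyBump.wMeasure σ) →
        eLpNorm (EntropyBump.fracMaximal α (fun x => f x * σ x)) (ENNReal.ofReal q)
            (EntropyBump.wMeasure w)
          ≤ C * EntropyBump.bump α p q ε σ w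
            * eLpNorm f (ENNReal.ofReal p) (EntropyBump.wMeasure σ) := by
  open EntropyBump in
  have hp0 : 0 < p := by linarith
  have hq0 : 0 < q := by linarith
  have hn : n ≠ 0 := by
    rintro rfl
    rw [Nat.cast_zero] at hαn
    linarith
  -- Factors: (6^n)^q from enlarging cubes, 2^n for the number of grids, 2^q from passing to
  -- principal cubes.
  set K : ℝ≥0∞ := (6 ^ n) ^ q * (2 ^ n * (2 ^ q * sparseConst p q c)) with hK
  have hKt : K ≠ ∞ := by
    refine ENNReal.mul_ne_top ?_ (ENNReal.mul_ne_top (by simp) (ENNReal.mul_ne_top ?_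
      (sparseConst_ne_top hp hq0 hc)))
    · exact ENNReal.rpow_ne_top_of_nonneg hq0.le (by simp)
    · exact ENNReal.rpow_ne_top_of_nonneg hq0.le (by simp)
  have hKq : K ^ (1 / q) ≠ ∞ := ENNReal.rpow_ne_top_of_nonneg (by positivity) hKt
  refine ⟨(K ^ (1 / q)).toNNReal, fun ε hε hcε hint σ w hσ hw f hf => ?_⟩
  rw [ENNReal.coe_toNNReal hKq]
  rw [eLpNorm_eq_lintegral_rpow_enorm_toReal (by simpa using hq0) ENNReal.ofReal_ne_top,
    eLpNorm_eq_lintegral_rpow_enorm_toReal (by simpa using hp0) ENNReal.ofReal_ne_top,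
    ENNReal.toReal_ofReal hp0.le, ENNReal.toReal_ofReal hq0.le]
  simp only [enorm_eq_self]
  set N := ∫⁻ x, ‖f x‖ₑ ^ p ∂(wMeasure σ) with hN
  set B := bump α p q ε σ w with hB
  set H : (Fin n → Bool) → (Fin n → ℝ) → ℝ≥0∞ := fun t x =>
    ⨆ i, (dyadicCube t i).toSet.indicator
      (fun _ => fracAvg σ (1 - α / n) (fun y => ‖f y‖ₑ) (dyadicCube t i) ^ q) x with hH
  have hHm : ∀ t, Measurable (H t) := fun t =>
    Measurable.iSup fun i => measurable_const.indicator (dyadicCube t i).measurableSet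
  have hmain : ∫⁻ x, fracMaximal α (fun x => f x * σ x) x ^ q ∂(wMeasure w)
      ≤ K * (B ^ q * N ^ (q / p)) := by
    calc ∫⁻ x, fracMaximal α (fun x => f x * σ x) x ^ q ∂(wMeasure w)
        ≤ ∫⁻ x, (6 ^ n) ^ q * ∑ t, H t x ∂(wMeasure w) :=
          lintegral_mono fun x => fracMaximal_rpow_le hα.le hαn hq0 hσ hf x
      _ = (6 ^ n) ^ q * ∑ t, ∫⁻ x, H t x ∂(wMeasure w) := by
          rw [lintegral_const_mul _ (Finset.measurable_fun_sum _ fun t _ => hHm t),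
            lintegral_finsetSum _ fun t _ => hHm t]
      _ ≤ (6 ^ n) ^ q * ∑ _t : Fin n → Bool,
          2 ^ q * sparseConst p q c * (B ^ q * N ^ (q / p)) := by
          gcongr with t
          exact lintegral_iSup_fracAvg_le hα.le hαn hp hpq hc hε hcε hint hσ hw hf.enorm
            (injective_dyadicCube hn t) (laminar_dyadicCube t)
      _ = _ := by
          rw [Finset.sum_const, Finset.card_univ, Fintype.card_fun, Fintype.card_bool,
            Fintype.card_fin, nsmul_eq_mul, hK]
          push_cast
          ring
  calc (∫⁻ x, fracMaximal α (fun x => f x * σ x) x ^ q ∂(wMeasure w)) ^ (1 / q)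
      ≤ (K * (B ^ q * N ^ (q / p))) ^ (1 / q) := by gcongr
    _ = K ^ (1 / q) * B * N ^ (1 / p) := by
        have hq' : 0 ≤ 1 / q := by positivity
        clear_value K
        rw [ENNReal.mul_rpow_of_nonneg _ _ hq', ENNReal.mul_rpow_of_nonneg _ _ hq',
          ← ENNReal.rpow_mul, ← ENNReal.rpow_mul, mul_one_div_cancel hq0.ne', ENNReal.rpow_one,
          mul_assoc]
        congr 3
        field_simp
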